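/- We work over $\mathbb C$. A plane curve is given, in an affine chart, by a polynomial in $\mathbb C[x,y]$, and $i(C,D,P)=\dim_{\mathbb C}\mathcal O_P/(f,g)\in\mathbb N\cup\{\infty\}$ denotes the intersection multiplicity at $P$ of the curves $C:f=0$ and $D:g=0$, where $\mathcal O_P$ is the local ring of the plane at $P$. A double point (point of multiplicity $2$) $P$ of $C$ is of type $A_s$, where $s=2r-\varepsilon$ with $\varepsilon\in\{0,1\}$, if it is resolved by $r$ blow-ups and the desingularization has two points over $P$ if $\varepsilon=1$ and only one if $\varepsilon=0$. Let $C$ be a reduced plane curve, $P$ a double point of $C$ and $r\ge 1$ an integer. (i) Let $P$ be of type $A_{2r-1}$ or $A_{2r}$, and let $D$ be a plane curve smooth at $P$. If $i(C,D,P)\le 2r$, then $i(C,D,P)$ is even. (ii) If $P$ is of type $A_{2r-1}$, there are plane curves $D_1,D_2$, smooth at $P$, such that $i(C,D_j,P)\ge 2r+1$ for $j=1,2$ and $i(D_1,D_2,P)=r$. (iii) If $P$ is of type $A_{2r}$, then $i(C,D,P)\le 2r+1$ for every plane curve $D$ smooth at $P$, and there are plane curves smooth at $P$ for which equality holds. If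 $D_1,D_2$ are plane curves smooth at $P$ with $i(C,D_j,P)=2r+1$ for $j=1,2$, then $i(D_1,D_2,P)>r$. (iv) Let the origin $O$ be a double point of $C$ of type $A_s$ with $s\ge 2$ and $s=2r-1$ or $s=2r$, and suppose that the tangent of $C$ at $O$ is not the $y$-axis. This tangent is a unique line $y=\gamma_1x$. Every plane curve $D$, smooth at $O$ and with $i(C,D,O)\ge 2r+1$, has near $O$ a local analytic equation $$y=\gamma_1x+\sum_{i\ge 2}c_ix^i$$ with a convergent power series on the right (so the linear term is absent if the tangent is the $x$-axis). If $s=2r$, the coefficients $c_2,\dots,c_r$ depend only on $C$ and not on $D$. If $s=2r-1$, the coefficients $c_2,\dots,c_{r-1}$ depend only on $C$, and there are exactly two different values, depending only on $C$, that $c_r$ takes as $D$ varies. -/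

import Mathlib

open Topology

noncomputable section

namespace PlaneCurve

/-- Polynomials in two variables over the complex numbers; `X 0` is `x` and `X 1` is `y`.
A plane curve is given by such a polynomial, a point of the plane is a vector `Fin 2 → ℂ`. -/
abbrev Poly : Type := MvPolynomial (Fin 2) ℂ

/-- The equation of the curve in the coordinates centred at `P`, that is `f (x + P)`. -/
def translate (P : Fin 2 → ℂ) (f : Poly) : Poly :=
  MvPolynomial.aeval (fun i => MvPolynomial.X i + MvPolynomial.C (P i)) f

/-- Multiplicity of a (nonzero) `f` at the origin: the least degree of a nonzero homogeneous
component. It is `0` iff the curve does not pass through the origin. -/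
def multO (f : Poly) : ℕ :=
  sInf {k | MvPolynomial.homogeneousComponent k f ≠ 0}

/-- The curve `f = 0` passes through `P` and is smooth there. -/
def IsSmoothAt (f : Poly) (P : Fin 2 → ℂ) : Prop :=
  MvPolynomial.eval P f = 0 ∧ ∃ i, MvPolynomial.eval P (MvPolynomial.pderiv i f) ≠ 0

/-- `P` is a double point of the curve `f = 0`. -/
def IsDoublePoint (f : Poly) (P : Fin 2 → ℂ) : Prop :=
  multO (translate P f) = 2

/-- The line through the origin with direction `v ≠ 0` is tangent to the curve `f = 0` at the
origin: it lies in the tangent cone, the zero locus of the lowest homogeneous component. -/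
def IsTangentO (f : Poly) (v : Fin 2 → ℂ) : Prop :=
  MvPolynomial.eval v (MvPolynomial.homogeneousComponent (multO f) f) = 0

/-! ### Intersection multiplicity -/

/-- The maximal ideal of the polynomials vanishing at `P`. -/
def maxIdealAt (P : Fin 2 → ℂ) : Ideal Poly :=
  RingHom.ker (MvPolynomial.eval P)

instance maxIdealAt_isPrime (P : Fin 2 → ℂ) : (maxIdealAt P).IsPrime :=
  RingHom.ker_isPrime _

/-- The local ring of the plane at `P`. -/
abbrev LocalRingAt (P : Fin 2 → ℂ) : Type := Localization.AtPrime (maxIdealAt P)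

/-- The intersection multiplicity of `f = 0` and `g = 0` at `P`: the complex dimension
(`⊤` if infinite) of the local ring of the plane at `P` modulo `(f, g)`. -/
def interMult (f g : Poly) (P : Fin 2 → ℂ) : ℕ∞ :=
  Cardinal.toENat (Module.rank ℂ (LocalRingAt P ⧸
    (Ideal.span {algebraMap Poly (LocalRingAt P) f, algebraMap Poly (LocalRingAt P) g} :
      Ideal (LocalRingAt P))))

/-! ### Blowing up the origin

The exceptional line of the blow-up of the plane at the origin is the set of directions
`Option ℂ`: `some t` is the direction of the line `y = t x`, `none` that of `x = 0`.
Near the point `some t` the blow-up has coordinates `u, v`, centred at this point, with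
`x = u` and `y = u (v + t)`, and the exceptional line is `u = 0`.
Near the point `none` it has coordinates `u, v`, centred at this point, with
`x = u v` and `y = v`, and the exceptional line is `v = 0`. -/

/-- The blow-up map in the coordinates centred at the point `d` of the exceptional line. -/
def blowUpMap : Option ℂ → Fin 2 → Poly
  | some t => ![MvPolynomial.X 0, MvPolynomial.X 0 * (MvPolynomial.X 1 + MvPolynomial.C t)]
  | none => ![MvPolynomial.X 0 * MvPolynomial.X 1, MvPolynomial.X 1]

/-- The coordinate whose vanishing is the exceptional line near the point `d`. -/
def excCoord : Option ℂ → Fin 2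
  | some _ => 0
  | none => 1

/-- The strict transform of the curve `f = 0`, in the coordinates centred at the point `d` of the
exceptional line: the pull-back of `f`, divided by the `m`-th power of the equation of the
exceptional line, where `m` is the multiplicity of `f` at the origin. This division is exact. -/
def strictTransform (d : Option ℂ) (f : Poly) : Poly :=
  MvPolynomial.divMonomial (MvPolynomial.aeval (blowUpMap d) f)
    (Finsupp.single (excCoord d) (multO f))

/-- `ResolvedBy f n k`: the germ at the origin of the curve `f = 0` is desingularized by `n`
blow-ups at singular points (the origin and points infinitely near to it), and the
desingularization has exactly `k` points over the origin. A smooth germ needs no blow-up. A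
singular germ is blown up once; this produces the germs of the strict transform at its finitely
many points on the exceptional line, each of which has to be resolved. -/
inductive ResolvedBy : Poly → ℕ → ℕ → Prop
  | smooth (f : Poly) (hf : IsSmoothAt f 0) : ResolvedBy f 0 1
  | blowUp (f : Poly) (hf : 2 ≤ multO f) (S : Finset (Option ℂ))
      (hS : ∀ d, d ∈ S ↔ MvPolynomial.eval 0 (strictTransform d f) = 0)
      (n k : Option ℂ → ℕ)
      (h : ∀ d ∈ S, ResolvedBy (strictTransform d f) (n d) (k d)) :
      ResolvedBy f (1 + ∑ d ∈ S, n d) (∑ d ∈ S, k d)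

/-- `P` is a singularity of type `A_s` of the curve `f = 0`: a double point which, for
`s = 2 r - e` with `e ∈ {0, 1}`, is resolved by `r` blow-ups, the desingularization having
two points over `P` if `e = 1` and only one if `e = 0`. -/
def IsTypeA (f : Poly) (P : Fin 2 → ℂ) (s : ℕ) : Prop :=
  IsDoublePoint f P ∧
    ∃ r e : ℕ, e ≤ 1 ∧ s + e = 2 * r ∧ ResolvedBy (translate P f) r (1 + e)

/-! ### Local analytic equations -/

/-- Near the origin the curve `g = 0` has the analytic equation `y = ∑ c i * x ^ i`, the power
series being convergent near `0`. -/
def HasLocalEquation (g : Poly) (c : ℕ → ℂ) : Prop :=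
  ∃ φ : ℂ → ℂ, HasFPowerSeriesAt φ (FormalMultilinearSeries.ofScalars ℂ c) 0 ∧
    ∀ᶠ p : Fin 2 → ℂ in 𝓝 0, MvPolynomial.eval p g = 0 ↔ p 1 = φ (p 0)

end PlaneCurve

end

noncomputable section

namespace PlaneCurve

open MvPolynomial hiding coeff constantCoeff coeff_smul coeff_C_mul
open PowerSeries hiding X C aeval monomial trunc map

/-! A curve smooth at the point is parametrized by a regular formal arc, and its intersection
multiplicity with `f` is the order of `f` along that arc (`interMult_eq_order`). All the claims thus
concern the orders of one polynomial along regular arcs.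

These orders are governed by smooth germs. For type A_{2r} there is a smooth `h` with ord f = min(2
ord h, 2r+1) along every arc (`IsEvenType`). For type A_{2r-1} there are smooth `h₁`, `h₂` with
contact exactly r, such that ord f and ord h₁ + ord h₂ agree when cut off at 2r+1 (`IsOddType`).
`ResolvedBy.classified` proves this by induction on the resolution. With two distinct tangents r =
1, and the tangent lines serve as `h₁`, `h₂`. With a single tangent, an arc transversal to it gives
order 2, while a tangent arc lifts to the blow-up: ord f is 2 plus the order of the strict
transform, and a germ that is a graph upstairs gains 1 when blown down. Hence r grows by one at each
step. The even chain starts with a smooth strict transform tangent to the exceptional line.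

Parts (i) to (iii) are then arithmetic of orders, with `h`, or `h₁` and `h₂`, as the extremal
curves. For (iv), the order of `h` along a graph y = s(x) is the order of s minus the series of `h`
(`order_aeval_graph`), so contact greater than r fixes the coefficients up to x^r. The series of
`h₁` and `h₂` first differ at x^r, whence the two values. -/

/-- A regular formal arc through the origin. -/
def IsArc (γ : Fin 2 → ℂ⟦X⟧) : Prop :=
  (∀ i, constantCoeff (γ i) = 0) ∧ ∃ i, coeff 1 (γ i) ≠ 0

/-! ### Colength of an ideal as an order along a branch -/

/-- The image of `l ^ n` has order exactly n, so a scalar multiple of it corrects the coefficient of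
index n without disturbing the earlier ones. This makes `coeffsBelow` surjective. -/
theorem exists_sub_coeff_order {A : Type} [CommRing A] [Algebra ℂ A] (Ψ : A →ₐ[ℂ] ℂ⟦X⟧) {l : A}
    (hl : (Ψ l).order = 1) (s : ℂ⟦X⟧) (n : ℕ) : ∃ a, (n : ℕ∞) ≤ (Ψ a - s).order := by
  induction n with
  | zero => exact ⟨0, by simp⟩
  | succ n ih =>
    obtain ⟨a, ha⟩ := ih
    have h1 : (Ψ (l ^ n)).order = n := by simp [map_pow, order_pow, hl]
    have h2 : coeff n (Ψ (l ^ n)) ≠ 0 := (order_eq_nat.1 h1).1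
    refine ⟨a - (coeff n (Ψ a - s) / coeff n (Ψ (l ^ n))) • l ^ n, nat_le_order _ _ fun i hi => ?_⟩
    rw [map_sub Ψ, map_smul, sub_right_comm, map_sub, PowerSeries.coeff_smul]
    rcases Nat.lt_succ_iff_lt_or_eq.1 hi with h | rfl
    · rw [coeff_of_lt_order i (lt_of_lt_of_le (by exact_mod_cast h) ha),
        coeff_of_lt_order i (by rw [h1]; exact_mod_cast h)]
      simp
    · rw [smul_eq_mul, div_mul_cancel₀ _ h2, sub_self]

/-- Modulo `g`, the elements without constant term are the multiples of `l`, and each factor `l`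
accounts for one unit of order. -/
theorem exists_eq_pow_mul_add {A : Type} [CommRing A] [Algebra ℂ A] (Ψ : A →ₐ[ℂ] ℂ⟦X⟧) {l g : A}
    (hg : Ψ g = 0) (hl : (Ψ l).order = 1)
    (hm : ∀ a, constantCoeff (Ψ a) = 0 → ∃ u v, a = l * u + g * v) (n : ℕ) (a : A)
    (ha : (n : ℕ∞) ≤ (Ψ a).order) : ∃ u v, a = l ^ n * u + g * v := by
  induction n with
  | zero => exact ⟨a, 0, by simp⟩
  | succ n ih =>
    obtain ⟨u, v, rfl⟩ := ih (le_trans (by exact_mod_cast n.le_succ) ha)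
    have h1 : (Ψ (l ^ n)).order = n := by simp [map_pow, order_pow, hl]
    rw [map_add, map_mul, map_mul, hg, zero_mul, add_zero, order_mul, h1] at ha
    have : 1 ≤ (Ψ u).order := by
      push_cast at ha
      exact (ENat.add_le_add_iff_left (ENat.natCast_ne_top n)).1 ha
    obtain ⟨u', v', rfl⟩ := hm u (one_le_order_iff_constCoeff_eq_zero.1 this)
    exact ⟨u', l ^ n * v' + v, by ring⟩

/-- The coefficients up to order `n` of the image in `ℂ⟦X⟧`. -/
def coeffsBelow {A : Type} [CommRing A] [Algebra ℂ A] (Ψ : A →ₐ[ℂ] ℂ⟦X⟧) (n : ℕ) :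
    A →ₗ[ℂ] (Fin n → ℂ) :=
  LinearMap.pi fun i => (PowerSeries.coeff (R := ℂ) (i : ℕ)).comp Ψ.toLinearMap

/-- Modulo `g`, the ring behaves like a discrete valuation ring with uniformizer `l`. The
coefficients below n give a surjection from the quotient onto ℂⁿ for every n up to the order, which
also settles infinite order; for finite order n this surjection is injective. -/
theorem rank_quotient_eq_order {A : Type} [CommRing A] [Algebra ℂ A] (Ψ : A →ₐ[ℂ] ℂ⟦X⟧) {l g : A}
    (hg : Ψ g = 0) (hl : (Ψ l).order = 1)
    (hm : ∀ a, constantCoeff (Ψ a) = 0 → ∃ u v, a = l * u + g * v)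
    (hu : ∀ a, constantCoeff (Ψ a) ≠ 0 → IsUnit a) (f : A) :
    Cardinal.toENat (Module.rank ℂ (A ⧸ (Ideal.span {f, g} : Ideal A))) = (Ψ f).order := by
  set I : Ideal A := Ideal.span {f, g} with hI
  have hker : ∀ n : ℕ, (n : ℕ∞) ≤ (Ψ f).order → ∀ a ∈ I, coeffsBelow Ψ n a = 0 := by
    intro n hn a ha
    obtain ⟨u, v, rfl⟩ := Ideal.mem_span_pair.1 ha
    ext i
    have : (n : ℕ∞) ≤ (Ψ (u * f + v * g)).order := by
      rw [map_add, map_mul, map_mul, hg, mul_zero, add_zero, order_mul]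
      exact hn.trans le_add_self
    exact coeff_of_lt_order _ (lt_of_lt_of_le (by exact_mod_cast i.2) this)
  have hsurj : ∀ n : ℕ, Function.Surjective (coeffsBelow Ψ n) := by
    intro n w
    obtain ⟨a, ha⟩ := exists_sub_coeff_order Ψ hl
      (PowerSeries.mk fun i => if h : i < n then w ⟨i, h⟩ else 0) n
    refine ⟨a, funext fun i => ?_⟩
    have := coeff_of_lt_order (i : ℕ) (lt_of_lt_of_le (by exact_mod_cast i.2) ha)
    rw [map_sub, coeff_mk, dif_pos i.2, sub_eq_zero] at this
    exact this
  let L : ∀ n : ℕ, (n : ℕ∞) ≤ (Ψ f).order → (A ⧸ I) →ₗ[ℂ] (Fin n → ℂ) := fun n hn =>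
    (Submodule.liftQ (I.restrictScalars ℂ) (coeffsBelow Ψ n) (fun a ha => hker n hn a ha))
  have hLs : ∀ n hn, Function.Surjective (L n hn) := by
    intro n hn w
    obtain ⟨a, rfl⟩ := hsurj n w
    exact ⟨Ideal.Quotient.mk I a, rfl⟩
  have hle : ∀ n : ℕ, (n : ℕ∞) ≤ (Ψ f).order →
      (n : ℕ∞) ≤ Cardinal.toENat (Module.rank ℂ (A ⧸ I)) := by
    intro n hn
    rw [Cardinal.natCast_le_toENat]
    have h2 := LinearMap.rank_le_of_surjective (L n hn) (hLs n hn)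
    simpa using h2
  refine le_antisymm ?_ (ENat.forall_natCast_le_iff_le.1 hle)
  by_cases htop : (Ψ f).order = ⊤
  · simp [htop]
  obtain ⟨n, hn⟩ := ENat.ne_top_iff_exists.1 htop
  rw [← hn, Cardinal.toENat_le_natCast]
  have hinj : Function.Injective (L n hn.le) := by
    rw [injective_iff_map_eq_zero]
    intro q hq
    obtain ⟨a, rfl⟩ := Ideal.Quotient.mk_surjective q
    have hq' : coeffsBelow Ψ n a = 0 := hq
    have hao : (n : ℕ∞) ≤ (Ψ a).order := nat_le_order _ _ fun i hi => congrFun hq' ⟨i, hi⟩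
    obtain ⟨u, v, rfl⟩ := exists_eq_pow_mul_add Ψ hg hl hm n a hao
    obtain ⟨u', v', hf⟩ := exists_eq_pow_mul_add Ψ hg hl hm n f hn.le
    have hl' : (Ψ (l ^ n)).order = n := by simp [map_pow, order_pow, hl]
    -- Otherwise the order of `f` would exceed n. Since `u'` is invertible, `l ^ n` lies in the
    -- ideal generated by `f` and `g`.
    have hu' : IsUnit u' := by
      apply hu
      intro h0
      have h1 := one_le_order_iff_constCoeff_eq_zero.2 h0
      have h2 : (Ψ f).order = n + (Ψ u').order := by
        rw [hf, map_add, map_mul, map_mul, hg, zero_mul, add_zero, order_mul, hl']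
      rw [← hn] at h2
      have h3 : (n : ℕ∞) + 1 ≤ n := by
        conv_rhs => rw [h2]
        gcongr
      exact absurd h3 (by exact_mod_cast (Nat.not_succ_le_self n))
    obtain ⟨w, hw⟩ := hu'.exists_right_inv
    rw [Ideal.Quotient.eq_zero_iff_mem]
    refine Ideal.mem_span_pair.2 ⟨w * u, v - v' * w * u, ?_⟩
    rw [hf]
    linear_combination (l ^ n * u) * hw
  have := LinearMap.rank_le_of_injective (L n hn.le) hinj
  simpa using this

/-! ### Arcs and the local ring of the plane -/

/-- First-order Taylor expansion with polynomial cofactors; their values at `P` are the partial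
derivatives there. -/
theorem exists_linear_decomposition (P : Fin 2 → ℂ) (p : Poly) : ∃ q₀ q₁ : Poly,
    p = C (eval P p) + (X 0 - C (P 0)) * q₀ + (X 1 - C (P 1)) * q₁ := by
  induction p using MvPolynomial.induction_on with
  | C a => exact ⟨0, 0, by simp⟩
  | add p q hp hq =>
    obtain ⟨a, b, h⟩ := hp
    obtain ⟨c, d, h'⟩ := hq
    refine ⟨a + c, b + d, ?_⟩
    rw [map_add, map_add]
    linear_combination h + h'
  | mul_X p i hp =>
    obtain ⟨a, b, h⟩ := hp
    fin_cases i
    · refine ⟨a * X 0 + C (eval P p), b * X 0, ?_⟩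
      simp only [map_mul, eval_X, Fin.zero_eta]
      linear_combination X 0 * h
    · refine ⟨a * X 1, b * X 1 + C (eval P p), ?_⟩
      simp only [map_mul, eval_X, Fin.mk_one]
      linear_combination X 1 * h

/-- The Taylor expansion of a polynomial along the arc `P + γ`. -/
def germ (P : Fin 2 → ℂ) (γ : Fin 2 → ℂ⟦X⟧) : Poly →ₐ[ℂ] ℂ⟦X⟧ :=
  aeval fun i => γ i + algebraMap ℂ ℂ⟦X⟧ (P i)

theorem germ_X (P γ) (i : Fin 2) : germ P γ (X i) = γ i + algebraMap ℂ ℂ⟦X⟧ (P i) := by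
  simp [germ]

theorem germ_C (P γ) (a : ℂ) : germ P γ (C a) = algebraMap ℂ ℂ⟦X⟧ a :=
  (germ P γ).commutes a

theorem germ_translate (P γ) (f : Poly) : aeval γ (translate P f) = germ P γ f := by
  have : (aeval γ).comp (aeval fun i => (X i + C (P i) : Poly)) = germ P γ := by
    ext i : 1
    simp [germ]
  exact DFunLike.congr_fun this f

theorem germ_zero (γ) (f : Poly) : germ 0 γ f = aeval γ f := by
  simp [germ]

theorem constantCoeff_germ {P γ} (hγ : IsArc γ) (f : Poly) :
    constantCoeff (germ P γ f) = eval P f := by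
  have : (PowerSeries.constantCoeff (R := ℂ)).comp (germ P γ).toRingHom = eval P := by
    apply MvPolynomial.ringHom_ext
    · intro r
      simp [germ]
    · intro i
      simp [germ, hγ.1 i]
  exact DFunLike.congr_fun this f

/-- The extension of `germ` to the local ring. -/
def localGerm (P : Fin 2 → ℂ) (γ : Fin 2 → ℂ⟦X⟧) (hγ : IsArc γ) :
    LocalRingAt P →ₐ[ℂ] ℂ⟦X⟧ :=
  IsLocalization.liftAlgHom (M := (maxIdealAt P).primeCompl) (f := germ P γ) fun y => by
    rw [PowerSeries.isUnit_iff_constantCoeff, isUnit_iff_ne_zero, constantCoeff_germ hγ]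
    exact y.2

theorem localGerm_algebraMap (P γ) (hγ : IsArc γ) (f : Poly) :
    localGerm P γ hγ (algebraMap Poly (LocalRingAt P) f) = germ P γ f := by
  simp [localGerm]

theorem pderiv_eval_of_decomposition {P : Fin 2 → ℂ} {p q₀ q₁ : Poly}
    (h : p = C (eval P p) + (X 0 - C (P 0)) * q₀ + (X 1 - C (P 1)) * q₁) :
    eval P (pderiv 0 p) = eval P q₀ ∧ eval P (pderiv 1 p) = eval P q₁ := by
  constructor <;> rw [h] <;> simp [pderiv_X]

theorem isUnit_algebraMap {P : Fin 2 → ℂ} {p : Poly} (h : eval P p ≠ 0) :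
    IsUnit (algebraMap Poly (LocalRingAt P) p) :=
  IsLocalization.map_units (LocalRingAt P) (⟨p, h⟩ : (maxIdealAt P).primeCompl)

theorem isUnit_of_localGerm {P γ} (hγ : IsArc γ) (a : LocalRingAt P)
    (ha : constantCoeff (localGerm P γ hγ a) ≠ 0) : IsUnit a := by
  obtain ⟨⟨p, s⟩, rfl⟩ := IsLocalization.mk'_surjective (maxIdealAt P).primeCompl a
  have h := IsLocalization.mk'_spec (LocalRingAt P) p s
  have h2 := congrArg (fun x => constantCoeff (localGerm P γ hγ x)) h
  simp only [map_mul, localGerm_algebraMap, constantCoeff_germ hγ] at h2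
  have hp : eval P p ≠ 0 := by
    rw [← h2]
    exact mul_ne_zero ha s.2
  have := isUnit_algebraMap hp
  rw [← h] at this
  exact isUnit_of_mul_isUnit_left this

/-- If `g` is smooth at `P` and vanishes along the arc `P + γ`, some coordinate function `l` and
`g` generate the maximal ideal of the local ring at `P`. -/
theorem exists_uniformizer {P γ} (hγ : IsArc γ) {g : Poly} (hg : IsSmoothAt g P)
    (h0 : germ P γ g = 0) : ∃ l : LocalRingAt P, (localGerm P γ hγ l).order = 1 ∧
      ∀ a, constantCoeff (localGerm P γ hγ a) = 0 →
        ∃ u v, a = l * u + algebraMap Poly (LocalRingAt P) g * v := by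
  obtain ⟨hgP, i, hi⟩ := hg
  obtain ⟨g₀, g₁, hdec⟩ := exists_linear_decomposition P g
  obtain ⟨hg₀, hg₁⟩ := pderiv_eval_of_decomposition hdec
  rw [hgP, C_0, zero_add] at hdec
  have hrel := congrArg (germ P γ) hdec
  simp only [map_add, map_mul, map_sub, germ_X, germ_C, add_sub_cancel_right, h0] at hrel
  -- The velocity of the arc is annihilated by the gradient of `g`. If one partial derivative is
  -- nonzero, the other coordinate must have order 1 along the arc, and it is the uniformizer chosen
  -- below.
  have hrel1 : 0 = coeff 1 (γ 0) * eval P g₀ + coeff 1 (γ 1) * eval P g₁ := by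
    have := congrArg (coeff 1) hrel
    simpa [PowerSeries.coeff_mul, Finset.Nat.antidiagonal_succ, hγ.1, constantCoeff_germ hγ]
      using this
  have hord : ∀ j, coeff 1 (γ j) ≠ 0 → (γ j).order = 1 := fun j hj => by
    refine order_eq_nat.2 ⟨hj, fun k hk => ?_⟩
    obtain rfl : k = 0 := by omega
    simpa using hγ.1 j
  -- reduction of an element of the maximal ideal to the two coordinate functions
  have hred : ∀ a : LocalRingAt P, constantCoeff (localGerm P γ hγ a) = 0 → ∃ u v,
      a = algebraMap Poly _ (X 0 - C (P 0)) * u + algebraMap Poly _ (X 1 - C (P 1)) * v := by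
    intro a ha
    obtain ⟨⟨p, s⟩, rfl⟩ := IsLocalization.mk'_surjective (maxIdealAt P).primeCompl a
    have h := IsLocalization.mk'_spec (LocalRingAt P) p s
    have h2 := congrArg (fun x => constantCoeff (localGerm P γ hγ x)) h
    simp only [map_mul, localGerm_algebraMap, constantCoeff_germ hγ, ha, zero_mul] at h2
    obtain ⟨q₀, q₁, hq⟩ := exists_linear_decomposition P p
    rw [← h2, C_0, zero_add] at hq
    obtain ⟨w, hw⟩ := (IsLocalization.map_units (LocalRingAt P) s).exists_right_inv
    refine ⟨w * algebraMap Poly _ q₀, w * algebraMap Poly _ q₁, ?_⟩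
    have hq' := congrArg (algebraMap Poly (LocalRingAt P)) hq
    rw [map_add, map_mul, map_mul] at hq'
    linear_combination (-IsLocalization.mk' (LocalRingAt P) p s) * hw + w * h + w * hq'
  have hdec' := congrArg (algebraMap Poly (LocalRingAt P)) hdec
  rw [map_add, map_mul, map_mul] at hdec'
  have hval : ∀ j, localGerm P γ hγ (algebraMap Poly _ (X j - C (P j))) = γ j := fun j => by
    rw [localGerm_algebraMap]
    simp [germ_X]
  fin_cases i
  · simp only [Fin.zero_eta] at hi
    rw [hg₀] at hi
    obtain ⟨w, hw⟩ := (isUnit_algebraMap hi).exists_right_inv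
    refine ⟨algebraMap Poly _ (X 1 - C (P 1)), ?_, fun a ha => ?_⟩
    · rw [hval]
      apply hord
      intro h1
      rw [h1, zero_mul, add_zero, eq_comm, mul_eq_zero, or_iff_left hi] at hrel1
      obtain ⟨j, hj⟩ := hγ.2
      fin_cases j <;> contradiction
    · obtain ⟨u, v, rfl⟩ := hred a ha
      refine ⟨v - w * algebraMap Poly _ g₁ * u, w * u, ?_⟩
      linear_combination (-w * u) * hdec' - algebraMap Poly _ (X 0 - C (P 0)) * u * hw
  · simp only [Fin.mk_one] at hi
    rw [hg₁] at hi
    obtain ⟨w, hw⟩ := (isUnit_algebraMap hi).exists_right_inv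
    refine ⟨algebraMap Poly _ (X 0 - C (P 0)), ?_, fun a ha => ?_⟩
    · rw [hval]
      apply hord
      intro h1
      rw [h1, zero_mul, zero_add, eq_comm, mul_eq_zero, or_iff_left hi] at hrel1
      obtain ⟨j, hj⟩ := hγ.2
      fin_cases j <;> contradiction
    · obtain ⟨u, v, rfl⟩ := hred a ha
      refine ⟨u - w * algebraMap Poly _ g₀ * v, w * v, ?_⟩
      linear_combination (-w * v) * hdec' - algebraMap Poly _ (X 1 - C (P 1)) * v * hw

/-- The intersection multiplicity with a smooth germ is the order along its parametrization. -/
theorem interMult_eq_order {P γ} (hγ : IsArc γ) {g : Poly} (hg : IsSmoothAt g P)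
    (h0 : germ P γ g = 0) (f : Poly) : interMult f g P = (germ P γ f).order := by
  obtain ⟨l, hl, hm⟩ := exists_uniformizer hγ hg h0
  have := rank_quotient_eq_order (localGerm P γ hγ) (g := algebraMap Poly _ g)
    (by rw [localGerm_algebraMap, h0]) hl hm (isUnit_of_localGerm hγ) (algebraMap Poly _ f)
  rw [localGerm_algebraMap] at this
  exact this

theorem interMult_comm (f g : Poly) (P) : interMult f g P = interMult g f P := by
  unfold interMult
  rw [Set.pair_comm]

/-- Contact of order n puts `h` in the ideal generated by `l ^ n` and `g` in the local ring, a
relation that can be evaluated along any other arc. -/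
theorem order_ge_of_contact {γ δ} (hγ : IsArc γ) (hδ : IsArc δ) {g h : Poly}
    (hg : IsSmoothAt g 0) (h0 : aeval γ g = 0) {n : ℕ} (hn : (n : ℕ∞) ≤ (aeval γ h).order) :
    min (aeval δ g).order n ≤ (aeval δ h).order := by
  rw [← germ_zero] at h0 hn
  obtain ⟨l, hl, hm⟩ := exists_uniformizer hγ hg h0
  obtain ⟨u, v, huv⟩ := exists_eq_pow_mul_add (localGerm 0 γ hγ) (g := algebraMap Poly _ g)
    (by rw [localGerm_algebraMap, h0]) hl hm n (algebraMap Poly _ h)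
    (by rw [localGerm_algebraMap]; exact hn)
  have h1 := congrArg (localGerm 0 δ hδ) huv
  rw [map_add, map_mul, map_mul, localGerm_algebraMap, localGerm_algebraMap, germ_zero, germ_zero]
    at h1
  have hl0 : constantCoeff (localGerm 0 δ hδ l) = 0 := by
    by_contra hne
    have hu := (isUnit_of_localGerm hδ l hne).map (localGerm 0 γ hγ)
    rw [order_zero_of_unit hu] at hl
    exact zero_ne_one hl
  have h2 : (n : ℕ∞) ≤ (localGerm 0 δ hδ (l ^ n)).order := by
    rw [map_pow]
    exact le_order_pow_of_constantCoeff_eq_zero n hl0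
  rw [h1]
  refine le_trans ?_ (min_order_le_order_add _ _)
  rw [order_mul, order_mul]
  exact le_min ((min_le_right _ _).trans (h2.trans le_self_add))
    ((min_le_left _ _).trans le_self_add)

/-- Smooth germs with contact of order `n` have the same order, up to `n`, along all arcs. -/
theorem min_order_eq_of_contact {γ γ' δ} (hγ : IsArc γ) (hγ' : IsArc γ') (hδ : IsArc δ)
    {g h : Poly} (hg : IsSmoothAt g 0) (h0 : aeval γ g = 0) (hh : IsSmoothAt h 0)
    (h0' : aeval γ' h = 0) {n : ℕ} (hn : (n : ℕ∞) ≤ (aeval γ h).order) :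
    min (aeval δ g).order n = min (aeval δ h).order n := by
  -- Contact is symmetric: both orders are the intersection multiplicity of `g` and `h`.
  have hn' : (n : ℕ∞) ≤ (aeval γ' g).order := by
    rw [← germ_zero] at h0 h0' hn ⊢
    rwa [← interMult_eq_order hγ' hh h0', interMult_comm, interMult_eq_order hγ hg h0]
  exact le_antisymm (le_min (order_ge_of_contact hγ hδ hg h0 hn) (min_le_right _ _))
    (le_min (order_ge_of_contact hγ' hδ hh h0' hn') (min_le_right _ _))

/-! ### Convergent expansions and the implicit function theorem -/

/-- Near `0` the function `φ` is the sum of the power series `s`. -/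
def HasTaylor (φ : ℂ → ℂ) (s : ℂ⟦X⟧) : Prop :=
  ∀ᶠ z in 𝓝 (0 : ℂ), HasSum (fun n => coeff n s * z ^ n) (φ z)

theorem hasTaylor_iff {φ : ℂ → ℂ} {c : ℕ → ℂ} :
    HasFPowerSeriesAt φ (FormalMultilinearSeries.ofScalars ℂ c) 0 ↔ HasTaylor φ (mk c) := by
  rw [hasFPowerSeriesAt_iff]
  simp [HasTaylor, FormalMultilinearSeries.coeff_ofScalars, mul_comm]

theorem HasTaylor.add {φ ψ : ℂ → ℂ} {s t : ℂ⟦X⟧} (h : HasTaylor φ s) (h' : HasTaylor ψ t) :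
    HasTaylor (fun z => φ z + ψ z) (s + t) := by
  filter_upwards [h, h'] with z h1 h2
  simpa [add_mul] using h1.add h2

theorem HasTaylor.mul {φ ψ : ℂ → ℂ} {s t : ℂ⟦X⟧} (h : HasTaylor φ s) (h' : HasTaylor ψ t) :
    HasTaylor (fun z => φ z * ψ z) (s * t) := by
  filter_upwards [h, h'] with z h1 h2
  have n1 := h1.summable.norm
  have n2 := h2.summable.norm
  have e : ∀ n, coeff n (s * t) * z ^ n =
      ∑ kl ∈ Finset.HasAntidiagonal.antidiagonal n, (coeff kl.1 s * z ^ kl.1) * (coeff kl.2 t * z ^ kl.2) := by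
    intro n
    rw [PowerSeries.coeff_mul, Finset.sum_mul]
    refine Finset.sum_congr rfl fun kl hkl => ?_
    rw [← Finset.HasAntidiagonal.mem_antidiagonal.1 hkl]
    ring
  simp_rw [e]
  have hs := (summable_norm_sum_mul_antidiagonal_of_summable_norm n1 n2).of_norm
  have := hs.hasSum
  rwa [← tsum_mul_tsum_eq_tsum_sum_antidiagonal_of_summable_norm n1 n2, h1.tsum_eq, h2.tsum_eq]
    at this

theorem hasTaylor_C (a : ℂ) : HasTaylor (fun _ => a) (algebraMap ℂ ℂ⟦X⟧ a) := by
  refine Filter.Eventually.of_forall fun z => ?_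
  convert hasSum_ite_eq (0 : ℕ) a using 2 with n
  rw [PowerSeries.algebraMap_apply, PowerSeries.coeff_C]
  split_ifs with h <;> simp [h]

theorem hasTaylor_X : HasTaylor (fun z => z) (PowerSeries.X : ℂ⟦X⟧) := by
  refine Filter.Eventually.of_forall fun z => ?_
  convert hasSum_ite_eq (1 : ℕ) z using 2 with n
  rw [PowerSeries.coeff_X]
  split_ifs with h <;> simp [h]

theorem HasTaylor.aeval {φ : ℂ → ℂ} {s : ℂ⟦X⟧} (h : HasTaylor φ s) (g : Poly) :
    HasTaylor (fun z => eval ![z, φ z] g) (MvPolynomial.aeval ![PowerSeries.X, s] g) := by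
  induction g using MvPolynomial.induction_on with
  | C a => simpa using hasTaylor_C a
  | add p q hp hq => simpa using hp.add hq
  | mul_X p i hp =>
    fin_cases i
    · simpa using hp.mul hasTaylor_X
    · simpa using hp.mul h

theorem HasTaylor.eq_zero {φ : ℂ → ℂ} {s : ℂ⟦X⟧} (h : HasTaylor φ s) (h0 : ∀ᶠ z in 𝓝 0, φ z = 0) :
    s = 0 := by
  have h1 : HasFPowerSeriesAt φ (FormalMultilinearSeries.ofScalars ℂ fun n => coeff n s) 0 := by
    rw [hasTaylor_iff]
    convert h
    ext n
    simp
  have h2 := h1.eq_zero_of_eventually h0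
  ext n
  have := congrArg (fun p => FormalMultilinearSeries.coeff p n) h2
  simp only [FormalMultilinearSeries.coeff_ofScalars] at this
  rw [this]
  simp [FormalMultilinearSeries.coeff]

theorem contDiff_eval (g : Poly) :
    ContDiff ℂ ⊤ fun p : ℂ × ℂ => eval ![p.1, p.2] g := by
  induction g using MvPolynomial.induction_on with
  | C a => simpa using contDiff_const
  | add p q hp hq => simpa using hp.add hq
  | mul_X p i hp =>
    fin_cases i
    · simpa using hp.mul contDiff_fst
    · simpa using hp.mul contDiff_snd

theorem hasDerivAt_eval_snd (g : Poly) (x y : ℂ) :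
    HasDerivAt (fun y => eval ![x, y] g) (eval ![x, y] (pderiv 1 g)) y := by
  induction g using MvPolynomial.induction_on with
  | C a => simpa using hasDerivAt_const y a
  | add p q hp hq => simpa using! hp.add hq
  | mul_X p i hp =>
    fin_cases i
    · simpa [pderiv_X, mul_comm] using hp.mul_const x
    · simpa [pderiv_X, mul_comm, add_comm] using! hp.mul (hasDerivAt_id y)

/-- Analytic implicit function theorem for polynomials, together with the corresponding formal
identity. -/
theorem exists_hasLocalEquation {g : Poly} (h0 : eval 0 g = 0) (h1 : eval 0 (pderiv 1 g) ≠ 0) :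
    ∃ c : ℕ → ℂ, c 0 = 0 ∧ HasLocalEquation g c ∧
      MvPolynomial.aeval ![PowerSeries.X, mk c] g = 0 := by
  set F : ℂ × ℂ → ℂ := fun p => eval ![p.1, p.2] g with hF
  have e0 : (![0, 0] : Fin 2 → ℂ) = 0 := by ext i; fin_cases i <;> rfl
  -- Here `⊤` lives in `WithTop ℕ∞` and means analytic, so the implicit function below has a
  -- convergent expansion.
  have cdf : ContDiffAt ℂ ⊤ F (0, 0) := (contDiff_eval g).contDiffAt
  have hne : (⊤ : WithTop ℕ∞) ≠ 0 := by simp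
  have hF0 : F (0, 0) = 0 := by rw [hF]; dsimp only; rw [e0, h0]
  have hder : HasFDerivAt F (fderiv ℂ F (0, 0)) (0, 0) :=
    (cdf.differentiableAt hne).hasFDerivAt
  have hd : (fderiv ℂ F (0, 0) ∘L .inr ℂ ℂ ℂ) 1 = eval 0 (pderiv 1 g) := by
    have hi : HasFDerivAt (fun y : ℂ => ((0 : ℂ), y)) (.inr ℂ ℂ ℂ) 0 := hasFDerivAt_prodMk_right 0 0
    have hc := (HasFDerivAt.comp (0 : ℂ) (f := fun y : ℂ => ((0 : ℂ), y)) hder hi).hasDerivAt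
    have := hc.unique (hasDerivAt_eval_snd g 0 0)
    rwa [e0] at this
  have hinv : (fderiv ℂ F (0, 0) ∘L .inr ℂ ℂ ℂ).IsInvertible := by
    refine ⟨ContinuousLinearEquiv.unitsEquivAut ℂ (Units.mk0 _ h1), ?_⟩
    refine ContinuousLinearMap.ext_ring ?_
    rw [hd]
    simp
  set φ := cdf.implicitFunction hne hinv with hφ
  have hφ0 : φ 0 = 0 := cdf.implicitFunction_apply_self hne hinv
  have hev := cdf.eventually_apply_implicitFunction hne hinv
  have hiff := cdf.eventually_apply_eq_iff_implicitFunction hne hinv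
  have hcd : ContDiffAt ℂ ⊤ φ 0 := cdf.contDiffAt_implicitFunction hne hinv
  obtain ⟨p, hp⟩ : AnalyticAt ℂ φ 0 := hcd.analyticAt
  have hT : HasTaylor φ (mk p.coeff) := by
    rw [hasFPowerSeriesAt_iff] at hp
    simpa [HasTaylor, mul_comm] using hp
  rw [hF0] at hev hiff
  refine ⟨p.coeff, ?_, ⟨φ, hasTaylor_iff.2 hT, ?_⟩, ?_⟩
  · have h := hT.self_of_nhds
    have h' := hasSum_single (f := fun n => coeff n (mk p.coeff) * (0 : ℂ) ^ n) 0
      (fun n hn => by simp [hn])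
    simpa [hφ0] using h'.unique h
  · have hcont : Filter.Tendsto (fun p : Fin 2 → ℂ => (p 0, p 1)) (𝓝 0) (𝓝 ((0 : ℂ), (0 : ℂ))) := by
      apply Continuous.tendsto' (by fun_prop)
      rfl
    filter_upwards [hcont.eventually hiff] with q hq
    have : (![q 0, q 1] : Fin 2 → ℂ) = q := by ext i; fin_cases i <;> rfl
    simp only [hF, this] at hq
    rw [hq, eq_comm]
  · exact (hT.aeval g).eq_zero hev

/-! ### Exchanging the coordinates -/

/-- Exchange of the two coordinates. -/
def swap : Poly →ₐ[ℂ] Poly := aeval ![X 1, X 0]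

theorem swap_X_zero : swap (X 0) = X 1 := by simp [swap]

theorem swap_X_one : swap (X 1) = X 0 := by simp [swap]

theorem swap_C (a : ℂ) : swap (C a) = C a := swap.commutes a

theorem swap_swap (f : Poly) : swap (swap f) = f := by
  have : swap.comp swap = AlgHom.id ℂ Poly := by
    ext i : 1
    fin_cases i <;> simp [swap]
  exact DFunLike.congr_fun this f

theorem aeval_swap {A : Type*} [CommRing A] [Algebra ℂ A] (γ : Fin 2 → A) (f : Poly) :
    aeval γ (swap f) = aeval ![γ 1, γ 0] f := by
  have : (aeval γ).comp swap = aeval ![γ 1, γ 0] := by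
    ext i : 1
    fin_cases i <;> simp [swap]
  exact DFunLike.congr_fun this f

theorem eval_zero_swap (f : Poly) : eval 0 (swap f) = eval 0 f := by
  have h := aeval_swap (0 : Fin 2 → ℂ) f
  have e : (![(0 : Fin 2 → ℂ) 1, (0 : Fin 2 → ℂ) 0]) = 0 := by ext i; fin_cases i <;> rfl
  rw [e] at h
  rwa [aeval_eq_eval] at h

theorem IsArc.swap {γ : Fin 2 → ℂ⟦X⟧} (h : IsArc γ) : IsArc ![γ 1, γ 0] := by
  refine ⟨fun i => by fin_cases i <;> simp [h.1], ?_⟩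
  obtain ⟨i, hi⟩ := h.2
  fin_cases i
  · exact ⟨1, hi⟩
  · exact ⟨0, hi⟩

theorem isSmoothAt_zero_iff {f : Poly} : IsSmoothAt f 0 ↔
    ∃ p q : Poly, f = X 0 * p + X 1 * q ∧ (eval 0 p ≠ 0 ∨ eval 0 q ≠ 0) := by
  constructor
  · rintro ⟨h0, i, hi⟩
    obtain ⟨p, q, h⟩ := exists_linear_decomposition 0 f
    obtain ⟨hp, hq⟩ := pderiv_eval_of_decomposition h
    refine ⟨p, q, ?_, ?_⟩
    · rw [h0] at h
      simpa using h
    · fin_cases i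
      · exact Or.inl (hp ▸ hi)
      · exact Or.inr (hq ▸ hi)
  · rintro ⟨p, q, rfl, h⟩
    have e : eval 0 (X 0 * p + X 1 * q : Poly) = 0 := by
      rw [map_add, map_mul, map_mul, eval_X, eval_X]
      simp
    obtain ⟨hp, hq⟩ := pderiv_eval_of_decomposition (P := 0) (p := X 0 * p + X 1 * q) (q₀ := p)
      (q₁ := q) (by rw [e]; simp)
    refine ⟨e, ?_⟩
    rcases h with h | h
    · exact ⟨0, hp ▸ h⟩
    · exact ⟨1, hq ▸ h⟩

theorem IsSmoothAt.swap {f : Poly} (h : IsSmoothAt f 0) : IsSmoothAt (swap f) 0 := by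
  obtain ⟨p, q, rfl, hpq⟩ := isSmoothAt_zero_iff.1 h
  refine isSmoothAt_zero_iff.2 ⟨PlaneCurve.swap q, PlaneCurve.swap p, ?_, ?_⟩
  · rw [map_add, map_mul, map_mul, swap_X_zero, swap_X_one, add_comm]
  · rw [eval_zero_swap, eval_zero_swap]
    exact hpq.symm

/-! ### Orders along arcs -/

/-- A perturbation of order at least n is invisible to orders cut off at n. -/
theorem min_order_add {n : ℕ∞} {s t : ℂ⟦X⟧} (h : n ≤ t.order) :
    min (s + t).order n = min s.order n := by
  apply le_antisymm
  · refine le_min ?_ (min_le_right _ _)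
    have := min_order_le_order_add (s + t) (-t)
    rw [add_neg_cancel_right, order_neg] at this
    exact (min_le_min_left _ h).trans this
  · exact le_min ((min_le_min_left _ h).trans (min_order_le_order_add s t)) (min_le_right _ _)

theorem constantCoeff_aeval {γ} (hγ : IsArc γ) (f : Poly) :
    constantCoeff (aeval γ f) = eval 0 f := by
  rw [← germ_zero, constantCoeff_germ hγ]

theorem one_le_order_aeval {γ} (hγ : IsArc γ) {f : Poly} (h : eval 0 f = 0) :
    1 ≤ (aeval γ f).order := by
  rw [one_le_order_iff_constCoeff_eq_zero, constantCoeff_aeval hγ, h]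

theorem order_eq_one_iff {s : ℂ⟦X⟧} :
    s.order = 1 ↔ constantCoeff s = 0 ∧ coeff 1 s ≠ 0 := by
  rw [show (1 : ℕ∞) = ((1 : ℕ) : ℕ∞) from rfl, order_eq_nat]
  constructor
  · rintro ⟨h, h'⟩
    exact ⟨by simpa using h' 0 one_pos, h⟩
  · rintro ⟨h, h'⟩
    refine ⟨h', fun i hi => ?_⟩
    obtain rfl : i = 0 := by omega
    simpa using h

theorem coeff_one_mul {s t : ℂ⟦X⟧} :
    coeff 1 (s * t) = constantCoeff s * coeff 1 t + coeff 1 s * constantCoeff t := by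
  simp [PowerSeries.coeff_mul, Finset.Nat.antidiagonal_succ]

theorem exists_arc {g : Poly} (hg : IsSmoothAt g 0) : ∃ γ, IsArc γ ∧ aeval γ g = 0 := by
  have key : ∀ g : Poly, eval 0 g = 0 → eval 0 (pderiv 1 g) ≠ 0 →
      ∃ γ, IsArc γ ∧ aeval γ g = 0 := by
    intro g h0 h1
    obtain ⟨c, hc, -, h⟩ := exists_hasLocalEquation h0 h1
    refine ⟨_, ⟨fun i => ?_, 0, ?_⟩, h⟩
    · fin_cases i <;> simp [hc]
    · simp
  obtain ⟨p, q, rfl, h⟩ := isSmoothAt_zero_iff.1 hg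
  rcases h with h | h
  · have hs : PlaneCurve.swap (X 0 * p + X 1 * q) =
        X 0 * PlaneCurve.swap q + X 1 * PlaneCurve.swap p := by
      rw [map_add, map_mul, map_mul, swap_X_zero, swap_X_one, add_comm]
    have h0 : eval 0 (PlaneCurve.swap (X 0 * p + X 1 * q)) = 0 := by
      rw [eval_zero_swap]
      exact hg.1
    have hd := (pderiv_eval_of_decomposition (P := 0)
      (p := PlaneCurve.swap (X 0 * p + X 1 * q)) (q₀ := PlaneCurve.swap q)
      (q₁ := PlaneCurve.swap p) (by rw [h0, hs]; simp)).2
    obtain ⟨γ, hγ, hz⟩ := key _ h0 (by rwa [hd, eval_zero_swap])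
    exact ⟨_, hγ.swap, by rwa [← aeval_swap]⟩
  · have h0 := hg.1
    have hd := (pderiv_eval_of_decomposition (P := 0) (p := X 0 * p + X 1 * q) (q₀ := p)
      (q₁ := q) (by rw [h0]; simp)).2
    exact key _ h0 (by rwa [hd])

/-! ### Expansion of a polynomial at the origin -/

/-- The binary quadratic form with coefficients `a, b, d`. -/
def quad (a b d : ℂ) : Poly := C a * X 0 ^ 2 + C b * (X 0 * X 1) + C d * X 1 ^ 2

theorem map_mem_pow {A : Type*} [CommRing A] [Algebra ℂ A] (φ : Poly →ₐ[ℂ] A) {J : Ideal A}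
    (h : ∀ i, φ (X i) ∈ J) {n : ℕ} {R : Poly} (hR : R ∈ idealOfVars (Fin 2) ℂ ^ n) :
    φ R ∈ J ^ n := by
  have h1 : (idealOfVars (Fin 2) ℂ).map φ ≤ J := by
    rw [Ideal.map_le_iff_le_comap, idealOfVars, Ideal.span_le]
    rintro _ ⟨i, rfl⟩
    exact h i
  have h2 := Ideal.mem_map_of_mem φ hR
  rw [Ideal.map_pow] at h2
  exact Ideal.pow_right_mono h1 n h2

theorem le_order_aeval_of_mem {γ} (hγ : IsArc γ) {n : ℕ} {R : Poly}
    (hR : R ∈ idealOfVars (Fin 2) ℂ ^ n) : (n : ℕ∞) ≤ (aeval γ R).order := by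
  have h := map_mem_pow (aeval γ) (J := Ideal.span {PowerSeries.X})
    (fun i => by
      rw [aeval_X, Ideal.mem_span_singleton, PowerSeries.X_dvd_iff]
      exact hγ.1 i) hR
  rw [Ideal.span_singleton_pow, Ideal.mem_span_singleton, PowerSeries.X_pow_dvd_iff] at h
  exact nat_le_order _ _ h

theorem exists_expansion (f : Poly) : ∃ (c a₀ a₁ a b d : ℂ) (R : Poly),
    R ∈ idealOfVars (Fin 2) ℂ ^ 3 ∧
      f = C c + (C a₀ * X 0 + C a₁ * X 1) + quad a b d + R := by
  have hdec : ∀ p : Poly, ∃ (c : ℂ) (q₀ q₁ : Poly), p = C c + X 0 * q₀ + X 1 * q₁ := fun p => by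
    obtain ⟨q₀, q₁, h⟩ := exists_linear_decomposition 0 p
    exact ⟨_, q₀, q₁, by simpa using h⟩
  have hX : ∀ i : Fin 2, (X i : Poly) ∈ idealOfVars (Fin 2) ℂ := fun i =>
    Ideal.subset_span ⟨i, rfl⟩
  have hXX : ∀ i j k : Fin 2, ∀ q : Poly, X i * X j * X k * q ∈ idealOfVars (Fin 2) ℂ ^ 3 := by
    intro i j k q
    rw [pow_succ, pow_two]
    exact Ideal.mul_mem_right _ _ (Ideal.mul_mem_mul (Ideal.mul_mem_mul (hX i) (hX j)) (hX k))
  obtain ⟨c, p, q, hf⟩ := hdec f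
  obtain ⟨a₀, p₀, p₁, hp⟩ := hdec p
  obtain ⟨a₁, q₀, q₁, hq⟩ := hdec q
  obtain ⟨e₁, r₁, s₁, h₁⟩ := hdec p₀
  obtain ⟨e₂, r₂, s₂, h₂⟩ := hdec p₁
  obtain ⟨e₃, r₃, s₃, h₃⟩ := hdec q₀
  obtain ⟨e₄, r₄, s₄, h₄⟩ := hdec q₁
  refine ⟨c, a₀, a₁, e₁, e₂ + e₃, e₄, X 0 * X 0 * X 0 * r₁ + X 0 * X 0 * X 1 * (s₁ + r₂ + r₃) +
    X 0 * X 1 * X 1 * (s₂ + s₃ + r₄) + X 1 * X 1 * X 1 * s₄, ?_, ?_⟩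
  · exact Ideal.add_mem _ (Ideal.add_mem _ (Ideal.add_mem _ (hXX _ _ _ _) (hXX _ _ _ _))
      (hXX _ _ _ _)) (hXX _ _ _ _)
  · rw [hf, hp, hq, h₁, h₂, h₃, h₄, quad, C_add]
    ring

theorem homogeneousComponent_of_expansion {f : Poly} {c a₀ a₁ a b d : ℂ} {R : Poly}
    (hR : R ∈ idealOfVars (Fin 2) ℂ ^ 3)
    (hf : f = C c + (C a₀ * X 0 + C a₁ * X 1) + quad a b d + R) :
    homogeneousComponent 0 f = C c ∧ homogeneousComponent 1 f = C a₀ * X 0 + C a₁ * X 1 ∧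
      homogeneousComponent 2 f = quad a b d := by
  have h0 : (C c : Poly) ∈ homogeneousSubmodule (Fin 2) ℂ 0 := isHomogeneous_C _ _
  have h1 : (C a₀ * X 0 + C a₁ * X 1 : Poly) ∈ homogeneousSubmodule (Fin 2) ℂ 1 :=
    (isHomogeneous_C_mul_X _ _).add (isHomogeneous_C_mul_X _ _)
  have h2 : quad a b d ∈ homogeneousSubmodule (Fin 2) ℂ 2 :=
    (((isHomogeneous_C_mul_X_pow _ _ _).add
      (((isHomogeneous_X ℂ (0 : Fin 2)).mul (isHomogeneous_X ℂ (1 : Fin 2))).C_mul b))).add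
        (isHomogeneous_C_mul_X_pow _ _ _)
  have h3 : ∀ k < 3, homogeneousComponent k R = 0 := fun k hk => by
    apply homogeneousComponent_eq_zero'
    intro m hm
    have := (mem_pow_idealOfVars_iff 3 R).1 hR m hm
    omega
  have key : ∀ k < 3, homogeneousComponent k f =
      (if k = 0 then C c else 0) + (if k = 1 then C a₀ * X 0 + C a₁ * X 1 else 0) +
        (if k = 2 then quad a b d else 0) := fun k hk => by
    rw [← homogeneousComponent_of_mem h0, ← homogeneousComponent_of_mem h1,
      ← homogeneousComponent_of_mem h2, ← map_add, ← map_add]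
    conv_lhs => rw [hf, map_add, h3 k hk, add_zero]
  exact ⟨by simpa using key 0 (by norm_num), by simpa using key 1 (by norm_num),
    by simpa using key 2 (by norm_num)⟩

theorem quad_eq_zero_iff {a b d : ℂ} : quad a b d = 0 ↔ a = 0 ∧ b = 0 ∧ d = 0 := by
  constructor
  · intro h
    have h1 := congrArg (eval ![1, 0]) h
    have h2 := congrArg (eval ![0, 1]) h
    have h3 := congrArg (eval ![1, 1]) h
    simp [quad] at h1 h2 h3
    simp_all
  · rintro ⟨rfl, rfl, rfl⟩
    simp [quad]

theorem exists_expansion_of_two_le {f : Poly} (hf : 2 ≤ multO f) : ∃ (a b d : ℂ) (R : Poly),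
    R ∈ idealOfVars (Fin 2) ℂ ^ 3 ∧ f = quad a b d + R := by
  obtain ⟨c, a₀, a₁, a, b, d, R, hR, h⟩ := exists_expansion f
  obtain ⟨h0, h1, -⟩ := homogeneousComponent_of_expansion hR h
  have hz : ∀ k < 2, homogeneousComponent k f = 0 := fun k hk => by
    by_contra hne
    exact absurd (Nat.sInf_le (s := {k | homogeneousComponent k f ≠ 0}) hne)
      (not_le.2 (lt_of_lt_of_le hk hf))
  rw [hz 0 (by norm_num)] at h0
  rw [hz 1 (by norm_num)] at h1
  exact ⟨a, b, d, R, hR, by rw [h, ← h0, ← h1]; ring⟩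

theorem homogeneousComponent_two_of_expansion {f : Poly} {a b d : ℂ} {R : Poly}
    (hR : R ∈ idealOfVars (Fin 2) ℂ ^ 3) (hf : f = quad a b d + R) :
    homogeneousComponent 2 f = quad a b d :=
  (homogeneousComponent_of_expansion (c := 0) (a₀ := 0) (a₁ := 0) hR (by rw [hf]; simp)).2.2

theorem multO_of_expansion {f : Poly} {a b d : ℂ} {R : Poly}
    (hR : R ∈ idealOfVars (Fin 2) ℂ ^ 3) (hf : f = quad a b d + R) (hne : quad a b d ≠ 0) :
    multO f = 2 := by
  obtain ⟨h0, h1, h2⟩ := homogeneousComponent_of_expansion (f := f) (c := 0) (a₀ := 0) (a₁ := 0)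
    (a := a) (b := b) (d := d) hR (by rw [hf]; simp)
  have hmem : homogeneousComponent 2 f ≠ 0 := by rwa [h2]
  refine le_antisymm (Nat.sInf_le hmem) (le_csInf ⟨2, hmem⟩ fun k hk => ?_)
  by_contra hlt
  have hlt' : k < 2 := by omega
  interval_cases k
  · exact hk (by rw [h0, C_0])
  · exact hk (by rw [h1]; simp)

theorem exists_expansion_of_multO_eq_two {f : Poly} (hf : multO f = 2) :
    ∃ (a b d : ℂ) (R : Poly), R ∈ idealOfVars (Fin 2) ℂ ^ 3 ∧ f = quad a b d + R ∧
      quad a b d ≠ 0 := by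
  obtain ⟨a, b, d, R, hR, h⟩ := exists_expansion_of_two_le hf.ge
  refine ⟨a, b, d, R, hR, h, ?_⟩
  rw [← homogeneousComponent_two_of_expansion hR h]
  -- The infimum of the empty set is 0, so the value 2 is attained by a nonzero component.
  have hne : {k | homogeneousComponent k f ≠ 0}.Nonempty := by
    by_contra hem
    rw [Set.not_nonempty_iff_eq_empty] at hem
    rw [multO, hem, Nat.sInf_empty] at hf
    omega
  have := Nat.sInf_mem hne
  rw [show sInf {k | homogeneousComponent k f ≠ 0} = 2 from hf] at this
  exact this

/-! ### Strict transforms of a double point -/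

/-- The pull-back of the cubic remainder is divisible by `X 0 ^ 3`, so one factor `X 0` survives in
front of `W` after removing the exceptional line twice. -/
theorem blowUp_some_of_expansion {f : Poly} {a b d : ℂ} {R : Poly}
    (hR : R ∈ idealOfVars (Fin 2) ℂ ^ 3) (hf : f = quad a b d + R) (t : ℂ) :
    ∃ W : Poly, aeval (blowUpMap (some t)) f = X 0 ^ 2 *
      (C (a + b * t + d * t ^ 2) + C (b + 2 * d * t) * X 1 + C d * X 1 ^ 2 + X 0 * W) := by
  have h := map_mem_pow (aeval (blowUpMap (some t))) (J := Ideal.span {X 0})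
    (fun i => by
      rw [aeval_X, Ideal.mem_span_singleton]
      fin_cases i
      · exact dvd_refl _
      · exact dvd_mul_right _ _) hR
  rw [Ideal.span_singleton_pow, Ideal.mem_span_singleton] at h
  obtain ⟨W, hW⟩ := h
  refine ⟨W, ?_⟩
  have e2 : (C 2 : Poly) = 2 := map_ofNat C 2
  rw [hf, map_add, hW, quad]
  simp [blowUpMap, algebraMap_eq, e2]
  ring

theorem strictTransform_some {f : Poly} {a b d : ℂ} {R : Poly}
    (hR : R ∈ idealOfVars (Fin 2) ℂ ^ 3) (hf : f = quad a b d + R) (hm : multO f = 2) (t : ℂ) :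
    aeval (blowUpMap (some t)) f = X 0 ^ 2 * strictTransform (some t) f ∧
    ∃ W : Poly, strictTransform (some t) f =
      C (a + b * t + d * t ^ 2) + C (b + 2 * d * t) * X 1 + C d * X 1 ^ 2 + X 0 * W := by
  obtain ⟨W, hW⟩ := blowUp_some_of_expansion hR hf t
  have h : strictTransform (some t) f =
      C (a + b * t + d * t ^ 2) + C (b + 2 * d * t) * X 1 + C d * X 1 ^ 2 + X 0 * W := by
    rw [strictTransform, hW, hm, X_pow_eq_monomial]
    exact divMonomial_monomial_mul _ _
  exact ⟨by rw [hW, h], W, h⟩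

theorem swap_quad (a b d : ℂ) : swap (quad a b d) = quad d b a := by
  simp only [quad, map_add, map_mul, map_pow, swap_C, swap_X_zero, swap_X_one]
  ring

theorem swap_mem {n : ℕ} {R : Poly} (hR : R ∈ idealOfVars (Fin 2) ℂ ^ n) :
    swap R ∈ idealOfVars (Fin 2) ℂ ^ n := by
  refine map_mem_pow swap (fun i => ?_) hR
  fin_cases i
  · exact swap_X_zero ▸ Ideal.subset_span ⟨1, rfl⟩
  · exact swap_X_one ▸ Ideal.subset_span ⟨0, rfl⟩

theorem multO_swap {f : Poly} (h : multO f = 2) : multO (swap f) = 2 := by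
  obtain ⟨a, b, d, R, hR, hf, hne⟩ := exists_expansion_of_multO_eq_two h
  refine multO_of_expansion (swap_mem hR) (by rw [hf, map_add, swap_quad]) ?_
  rw [Ne, quad_eq_zero_iff] at hne ⊢
  tauto

/-- Thanks to this symmetry, only the charts `some t` need to be studied. -/
theorem strictTransform_none {f : Poly} (h : multO f = 2) :
    strictTransform none f = swap (strictTransform (some 0) (swap f)) := by
  obtain ⟨a, b, d, R, hR, hf, hne⟩ := exists_expansion_of_multO_eq_two (multO_swap h)
  have h1 := (strictTransform_some hR hf (multO_swap h) 0).1
  have h2 : swap.comp ((aeval (blowUpMap (some 0))).comp swap) = aeval (blowUpMap none) := by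
    ext i : 1
    fin_cases i <;> simp [swap, blowUpMap, mul_comm]
  have h3 := DFunLike.congr_fun h2 f
  simp only [AlgHom.comp_apply] at h3
  rw [h1, map_mul, map_pow, swap_X_zero] at h3
  rw [strictTransform, ← h3, h, X_pow_eq_monomial]
  exact divMonomial_monomial_mul _ _

/-! ### Double points described by orders along arcs -/

/-- The orders `p, q` of two smooth germs with contact of order `r` along a smooth arc. -/
def ContactPair (r : ℕ) (p q : ℕ∞) : Prop :=
  (p = q ∧ p ≤ r) ∨ (r < p ∧ q = r) ∨ (p = r ∧ r < q)

/-- The behaviour along smooth arcs of a singularity of type `A_{2r}`. -/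
def IsEvenType (f : Poly) (r : ℕ) : Prop :=
  ∃ h : Poly, IsSmoothAt h 0 ∧ ∀ γ, IsArc γ →
    (aeval γ f).order = min (2 * (aeval γ h).order) ((2 * r + 1 : ℕ) : ℕ∞)

/-- The behaviour along smooth arcs of a singularity of type `A_{2r-1}`. -/
def IsOddType (f : Poly) (r : ℕ) : Prop :=
  1 ≤ r ∧ ∃ h₁ h₂ : Poly, IsSmoothAt h₁ 0 ∧ IsSmoothAt h₂ 0 ∧ ∀ γ, IsArc γ →
    ContactPair r (aeval γ h₁).order (aeval γ h₂).order ∧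
    min (aeval γ f).order ((2 * r + 1 : ℕ) : ℕ∞) =
      min ((aeval γ h₁).order + (aeval γ h₂).order) ((2 * r + 1 : ℕ) : ℕ∞)

theorem IsEvenType.of_swap {f : Poly} {r : ℕ} (hf : IsEvenType (swap f) r) : IsEvenType f r := by
  obtain ⟨h, hh, H⟩ := hf
  refine ⟨swap h, hh.swap, fun γ hγ => ?_⟩
  have h1 := H _ hγ.swap
  have h2 := aeval_swap γ (swap f)
  rw [swap_swap] at h2
  rw [h2, h1, aeval_swap]

theorem IsOddType.of_swap {f : Poly} {r : ℕ} (hf : IsOddType (swap f) r) : IsOddType f r := by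
  obtain ⟨hr, h₁, h₂, hh₁, hh₂, H⟩ := hf
  refine ⟨hr, swap h₁, swap h₂, hh₁.swap, hh₂.swap, fun γ hγ => ?_⟩
  have h1 := H _ hγ.swap
  have h2 := aeval_swap γ (swap f)
  rw [swap_swap] at h2
  rw [h2, aeval_swap, aeval_swap]
  exact h1

/-! ### Arithmetic of orders -/

@[norm_cast]
theorem natCast_min_enat (a b : ℕ) : ((min a b : ℕ) : ℕ∞) = min (a : ℕ∞) (b : ℕ∞) :=
  Nat.mono_cast.map_min

/-- Arithmetic of blowing down in the even case: `e` is the order upstairs of the germ, `x` that of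
its polynomial approximation. Precision n+1 suffices, because from there on both minima are attained
by the odd constants. -/
theorem two_add_min_eq {n : ℕ} {e x : ℕ∞}
    (h : min e ((n + 1 : ℕ) : ℕ∞) = min x ((n + 1 : ℕ) : ℕ∞)) :
    2 + min (2 * e) ((2 * n + 1 : ℕ) : ℕ∞) =
      min (2 * (1 + x)) ((2 * (n + 1) + 1 : ℕ) : ℕ∞) := by
  induction e using ENat.recTopCoe <;> induction x using ENat.recTopCoe <;>
    simp at h ⊢ <;> norm_cast at h ⊢ <;> omega

/-- The same for two germs: each gains 1 and `f` gains 2, so the contact and half the cut-off rise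
together. -/
theorem contactPair_succ {n : ℕ} {p q x y e : ℕ∞}
    (hp : min p ((n + 1 : ℕ) : ℕ∞) = min x ((n + 1 : ℕ) : ℕ∞))
    (hq : min q ((n + 1 : ℕ) : ℕ∞) = min y ((n + 1 : ℕ) : ℕ∞)) (h : ContactPair n p q)
    (he : min e ((2 * n + 1 : ℕ) : ℕ∞) = min (p + q) ((2 * n + 1 : ℕ) : ℕ∞)) :
    ContactPair (n + 1) (1 + x) (1 + y) ∧
      min (2 + e) ((2 * (n + 1) + 1 : ℕ) : ℕ∞) =
        min ((1 + x) + (1 + y)) ((2 * (n + 1) + 1 : ℕ) : ℕ∞) := by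
  unfold ContactPair at *
  induction e using ENat.recTopCoe <;> induction x using ENat.recTopCoe <;>
  induction y using ENat.recTopCoe <;>
  induction p using ENat.recTopCoe <;> induction q using ENat.recTopCoe <;>
    simp at h hp hq he ⊢ <;> norm_cast at h hp hq he ⊢ <;> omega

theorem order_eq_one_of_two_mul {e : ℕ∞} {n : ℕ} (h : 2 = min (2 * e) ((2 * n + 1 : ℕ) : ℕ∞)) :
    e = 1 := by
  induction e using ENat.recTopCoe <;> simp at h ⊢ <;> norm_cast at h ⊢ <;> omega

theorem order_eq_one_of_add {p q : ℕ∞} {n : ℕ} (hn : 1 ≤ n) (hp : 1 ≤ p) (hq : 1 ≤ q)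
    (h : min 2 ((2 * n + 1 : ℕ) : ℕ∞) = min (p + q) ((2 * n + 1 : ℕ) : ℕ∞)) :
    p = 1 ∧ q = 1 := by
  induction p using ENat.recTopCoe <;> induction q using ENat.recTopCoe <;>
    simp at h hp hq ⊢ <;> norm_cast at h hp hq ⊢ <;> omega

/-! ### Blowing down smooth germs -/

/-- The image under the blow-up map of the curve `v = p(u)` in the chart at the direction `t`. -/
def blowDown (t : ℂ) (p : Polynomial ℂ) : Poly :=
  X 1 - C t * X 0 - X 0 * Polynomial.aeval (X 0) p

theorem aeval_blowDown (γ : Fin 2 → ℂ⟦X⟧) (t : ℂ) (p : Polynomial ℂ) :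
    aeval γ (blowDown t p) =
      γ 1 - algebraMap ℂ ℂ⟦X⟧ t * γ 0 - γ 0 * Polynomial.aeval (γ 0) p := by
  rw [blowDown, map_sub, map_sub, map_mul, map_mul, aeval_X, aeval_X, aeval_C,
    ← Polynomial.aeval_algHom_apply, aeval_X]

theorem constantCoeff_aeval_polynomial {s : ℂ⟦X⟧} (hs : constantCoeff s = 0) {p : Polynomial ℂ}
    (hp : p.coeff 0 = 0) : constantCoeff (Polynomial.aeval s p) = 0 := by
  obtain ⟨q, rfl⟩ := Polynomial.X_dvd_iff.2 hp
  rw [map_mul, Polynomial.aeval_X, map_mul, hs, zero_mul]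

theorem isSmoothAt_sub_graph {p : Polynomial ℂ} (hp : p.coeff 0 = 0) :
    IsSmoothAt (X 1 - Polynomial.aeval (X 0) p : Poly) 0 := by
  obtain ⟨q, rfl⟩ := Polynomial.X_dvd_iff.2 hp
  refine isSmoothAt_zero_iff.2 ⟨-Polynomial.aeval (X 0) q, 1, ?_, Or.inr (by simp)⟩
  rw [map_mul, Polynomial.aeval_X]
  ring

theorem isSmoothAt_blowDown (t : ℂ) (p : Polynomial ℂ) : IsSmoothAt (blowDown t p) 0 :=
  isSmoothAt_zero_iff.2 ⟨-C t - Polynomial.aeval (X 0) p, 1, by rw [blowDown]; ring,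
    Or.inr (by simp)⟩

theorem order_blowDown_of_transversal {γ} (hγ : IsArc γ) {t : ℂ} {p : Polynomial ℂ}
    (hp : p.coeff 0 = 0) (h : coeff 1 (γ 1) ≠ t * coeff 1 (γ 0)) :
    (aeval γ (blowDown t p)).order = 1 := by
  rw [order_eq_one_iff, constantCoeff_aeval hγ, aeval_blowDown]
  refine ⟨(isSmoothAt_blowDown t p).1, ?_⟩
  rw [map_sub, map_sub, coeff_one_mul, coeff_one_mul,
    constantCoeff_aeval_polynomial (hγ.1 0) hp, hγ.1 0]
  simpa [sub_eq_zero] using h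

/-- Lifting of an arc to the blow-up: its second coordinate there is y/x - t, which is a power
series because x has order 1. -/
theorem exists_eq_mul_of_tangent {γ} (hγ : IsArc γ) {t : ℂ}
    (h : coeff 1 (γ 1) = t * coeff 1 (γ 0)) : (γ 0).order = 1 ∧
      ∃ b, IsArc ![γ 0, b] ∧ γ 1 = γ 0 * (b + algebraMap ℂ ℂ⟦X⟧ t) := by
  have h0 : coeff 1 (γ 0) ≠ 0 := by
    intro h0
    obtain ⟨i, hi⟩ := hγ.2
    fin_cases i
    · exact hi h0
    · exact hi (by simp [h, h0])
  obtain ⟨u, hu⟩ := PowerSeries.X_dvd_iff.2 (hγ.1 0)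
  obtain ⟨v, hv⟩ := PowerSeries.X_dvd_iff.2 (hγ.1 1)
  have cu : coeff 1 (γ 0) = constantCoeff u := by rw [hu, coeff_one_mul]; simp
  have cv : coeff 1 (γ 1) = constantCoeff v := by rw [hv, coeff_one_mul]; simp
  rw [cu] at h0
  rw [cu, cv] at h
  obtain ⟨w, hw⟩ := (PowerSeries.isUnit_iff_constantCoeff.2
    (isUnit_iff_ne_zero.2 h0)).exists_right_inv
  have cw : constantCoeff u * constantCoeff w = 1 := by rw [← map_mul, hw, map_one]
  refine ⟨order_eq_one_iff.2 ⟨hγ.1 0, by rwa [cu]⟩, v * w - algebraMap ℂ ℂ⟦X⟧ t,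
    ⟨fun i => ?_, 0, ?_⟩, ?_⟩
  · fin_cases i
    · exact hγ.1 0
    · simp only [Fin.mk_one, Matrix.cons_val_one, Matrix.cons_val_fin_one, map_sub, map_mul, h]
      rw [mul_assoc, cw]
      simp
  · simpa [cu] using h0
  · rw [sub_add_cancel, hu, hv]
    linear_combination (-PowerSeries.X * v) * hw

/-- A smooth germ transversal to `x = 0` is approximated by the graph of a polynomial. -/
theorem exists_graph_approximation {h : Poly} (h0 : eval 0 h = 0)
    (h1 : eval 0 (pderiv 1 h) ≠ 0) (N : ℕ) : ∃ p : Polynomial ℂ, p.coeff 0 = 0 ∧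
      ∀ δ, IsArc δ → min (aeval δ h).order N =
        min (δ 1 - Polynomial.aeval (δ 0) p).order N := by
  obtain ⟨c, hc, -, hz⟩ := exists_hasLocalEquation h0 h1
  -- The branch is only analytic; truncating its series gives a polynomial graph, which blows down
  -- to an algebraic curve.
  set p := PowerSeries.trunc (N + 1) (mk c) with hp
  have hp0 : p.coeff 0 = 0 := by simp [hp, PowerSeries.coeff_trunc, hc]
  have hcoe : Polynomial.aeval (PowerSeries.X : ℂ⟦X⟧) p = (p : ℂ⟦X⟧) :=
    p.eval₂_C_X_eq_coe
  have hq : ∀ δ : Fin 2 → ℂ⟦X⟧, aeval δ (X 1 - Polynomial.aeval (X 0) p : Poly) =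
      δ 1 - Polynomial.aeval (δ 0) p := fun δ => by
    rw [map_sub, aeval_X, ← Polynomial.aeval_algHom_apply, aeval_X]
  refine ⟨p, hp0, fun δ hδ => ?_⟩
  rw [← hq]
  refine min_order_eq_of_contact (γ := ![PowerSeries.X, mk c])
    (γ' := ![PowerSeries.X, Polynomial.aeval PowerSeries.X p]) ⟨fun i => ?_, 0, by simp⟩
    ⟨fun i => ?_, 0, by simp⟩ hδ ⟨h0, 1, h1⟩ hz (isSmoothAt_sub_graph hp0) ?_ ?_
  · fin_cases i <;> simp [hc]
  · fin_cases i
    · simp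
    · exact constantCoeff_aeval_polynomial (by simp) hp0
  · rw [hq]
    simp
  · rw [hq]
    refine nat_le_order _ _ fun i hi => ?_
    simp only [Matrix.cons_val_one, Matrix.cons_val_zero, Matrix.cons_val_fin_one]
    rw [hcoe, map_sub, Polynomial.coeff_coe, hp, PowerSeries.coeff_trunc, if_pos (by omega),
      sub_self]

/-! ### Double points with two tangents -/

theorem min_order_quad {γ} (hγ : IsArc γ) {f : Poly} {a b d : ℂ} {R : Poly}
    (hR : R ∈ idealOfVars (Fin 2) ℂ ^ 3) (hf : f = quad a b d + R) :
    min (aeval γ f).order 3 = min (aeval γ (quad a b d)).order 3 := by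
  rw [hf, map_add]
  exact min_order_add (le_order_aeval_of_mem hγ hR)

/-- The linear form with coefficients `a, b`. -/
def lin (a b : ℂ) : Poly := C a * X 0 + C b * X 1

theorem isSmoothAt_lin {a b : ℂ} (h : a ≠ 0 ∨ b ≠ 0) : IsSmoothAt (lin a b) 0 :=
  isSmoothAt_zero_iff.2 ⟨C a, C b, by rw [lin]; ring, by simpa using h⟩

theorem coeff_one_aeval_lin (γ : Fin 2 → ℂ⟦X⟧) (a b : ℂ) :
    coeff 1 (aeval γ (lin a b)) = a * coeff 1 (γ 0) + b * coeff 1 (γ 1) := by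
  simp [lin]

/-- At a node the two tangent lines do the job: no arc is tangent to both, and `f` differs from
their product by terms of order 3, which is the cut-off for r = 1. -/
theorem isOddType_one {f : Poly} {a b d : ℂ} {R : Poly}
    (hR : R ∈ idealOfVars (Fin 2) ℂ ^ 3) (hf : f = quad a b d + R) {a₁ b₁ a₂ b₂ : ℂ}
    (hq : quad a b d = lin a₁ b₁ * lin a₂ b₂) (hdet : a₁ * b₂ - a₂ * b₁ ≠ 0) :
    IsOddType f 1 := by
  refine ⟨le_rfl, lin a₁ b₁, lin a₂ b₂, isSmoothAt_lin ?_, isSmoothAt_lin ?_, fun γ hγ => ?_⟩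
  · by_contra! h
    simp [h] at hdet
  · by_contra! h
    simp [h] at hdet
  have h1 : ∀ a b : ℂ, 1 ≤ (aeval γ (lin a b)).order := fun a b =>
    one_le_order_aeval hγ (by rw [lin, map_add, map_mul, map_mul, eval_X, eval_X]; simp)
  have h2 : ∀ a b : ℂ, a * coeff 1 (γ 0) + b * coeff 1 (γ 1) ≠ 0 →
      (aeval γ (lin a b)).order = 1 := fun a b h => by
    rw [order_eq_one_iff]
    refine ⟨one_le_order_iff_constCoeff_eq_zero.1 (h1 a b), ?_⟩
    rwa [coeff_one_aeval_lin]
  constructor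
  · have h3 : (aeval γ (lin a₁ b₁)).order = 1 ∨ (aeval γ (lin a₂ b₂)).order = 1 := by
      by_contra! h
      have e1 := not_imp_comm.1 (h2 a₁ b₁) h.1
      have e2 := not_imp_comm.1 (h2 a₂ b₂) h.2
      have k0 : (a₁ * b₂ - a₂ * b₁) * coeff 1 (γ 0) = 0 := by
        linear_combination b₂ * e1 - b₁ * e2
      have k1 : (a₁ * b₂ - a₂ * b₁) * coeff 1 (γ 1) = 0 := by
        linear_combination a₁ * e2 - a₂ * e1
      obtain ⟨i, hi⟩ := hγ.2
      fin_cases i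
      · exact hi ((mul_eq_zero.1 k0).resolve_left hdet)
      · exact hi ((mul_eq_zero.1 k1).resolve_left hdet)
    unfold ContactPair
    rw [Nat.cast_one]
    rcases h3 with h3 | h3
    · rcases (h1 a₂ b₂).eq_or_lt with h | h
      · exact Or.inl ⟨h3.trans h, h3.le⟩
      · exact Or.inr (Or.inr ⟨h3, h⟩)
    · rcases (h1 a₁ b₁).eq_or_lt with h | h
      · exact Or.inl ⟨h.symm.trans h3.symm, h.ge⟩
      · exact Or.inr (Or.inl ⟨h, h3⟩)
  · have := min_order_quad hγ hR hf
    rw [hq, map_mul, order_mul] at this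
    exact this

/-! ### Double points with one tangent -/

theorem order_eq_of_min_eq {e : ℕ∞} (h : min e 3 = 2) : e = 2 := by
  rcases min_choice e 3 with h' | h' <;> rw [h'] at h
  · exact h
  · exact absurd h (by norm_num)

/-- A double point with the double tangent `y = t x`. -/
structure HasDoubleTangent (f : Poly) (t d : ℂ) (R : Poly) : Prop where
  mem : R ∈ idealOfVars (Fin 2) ℂ ^ 3
  eq : f = quad (d * t ^ 2) (-2 * d * t) d + R
  ne : d ≠ 0

theorem HasDoubleTangent.multO_eq {f : Poly} {t d : ℂ} {R : Poly} (H : HasDoubleTangent f t d R) :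
    multO f = 2 :=
  multO_of_expansion H.mem H.eq fun h => H.ne (quad_eq_zero_iff.1 h).2.2

theorem HasDoubleTangent.order_of_transversal {f : Poly} {t d : ℂ} {R : Poly}
    (H : HasDoubleTangent f t d R) {γ} (hγ : IsArc γ)
    (h : coeff 1 (γ 1) ≠ t * coeff 1 (γ 0)) : (aeval γ f).order = 2 := by
  apply order_eq_of_min_eq
  have hq : quad (d * t ^ 2) (-2 * d * t) d = C d * lin (-t) 1 ^ 2 := by
    have e2 : (C 2 : Poly) = 2 := map_ofNat C 2
    simp only [quad, lin, C_mul, C_neg, C_pow, C_1, e2]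
    ring
  have hl : (aeval γ (lin (-t) 1)).order = 1 := by
    rw [order_eq_one_iff, coeff_one_aeval_lin]
    refine ⟨one_le_order_iff_constCoeff_eq_zero.1 (one_le_order_aeval hγ
      (isSmoothAt_lin (Or.inr one_ne_zero)).1), fun h' => h ?_⟩
    linear_combination h'
  rw [min_order_quad hγ H.mem H.eq, hq, map_mul, map_pow, order_mul, order_pow, hl, aeval_C,
    order_zero_of_unit ((isUnit_iff_ne_zero.2 H.ne).map (algebraMap ℂ ℂ⟦X⟧))]
  rfl

theorem HasDoubleTangent.strictTransform_eq {f : Poly} {t d : ℂ} {R : Poly}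
    (H : HasDoubleTangent f t d R) :
    ∃ W, strictTransform (some t) f = C d * X 1 ^ 2 + X 0 * W := by
  obtain ⟨W, hW⟩ := (strictTransform_some H.mem H.eq H.multO_eq t).2
  refine ⟨W, ?_⟩
  rw [hW, show d * t ^ 2 + -2 * d * t * t + d * t ^ 2 = 0 by ring,
    show -2 * d * t + 2 * d * t = 0 by ring]
  simp

theorem HasDoubleTangent.order_of_tangent {f : Poly} {t d : ℂ} {R : Poly}
    (H : HasDoubleTangent f t d R) {γ : Fin 2 → ℂ⟦X⟧} {b : ℂ⟦X⟧} (h0 : (γ 0).order = 1)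
    (h1 : γ 1 = γ 0 * (b + algebraMap ℂ ℂ⟦X⟧ t)) :
    (aeval γ f).order = 2 + (aeval ![γ 0, b] (strictTransform (some t) f)).order := by
  have h := congrArg (aeval ![γ 0, b]) (strictTransform_some H.mem H.eq H.multO_eq t).1
  have hc : (aeval ![γ 0, b]).comp (aeval (blowUpMap (some t))) = aeval γ := by
    ext i : 1
    fin_cases i
    · simp [blowUpMap]
    · simp [blowUpMap, h1]
  have h2 := DFunLike.congr_fun hc f
  rw [AlgHom.comp_apply, h, map_mul, map_pow, aeval_X] at h2
  rw [← h2, order_mul, order_pow]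
  simp [h0]

theorem order_blowDown_of_tangent {γ : Fin 2 → ℂ⟦X⟧} {b : ℂ⟦X⟧} {t : ℂ} (h0 : (γ 0).order = 1)
    (h1 : γ 1 = γ 0 * (b + algebraMap ℂ ℂ⟦X⟧ t)) (p : Polynomial ℂ) :
    (aeval γ (blowDown t p)).order = 1 + (b - Polynomial.aeval (γ 0) p).order := by
  rw [aeval_blowDown, h1, ← h0, ← order_mul]
  congr 1
  ring

/-- The witness is the tangent line. The smooth strict transform is tangent to the exceptional line,
so every lifted arc meets it with order 1 and `f` has order 3 along every tangent arc. -/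
theorem HasDoubleTangent.isEvenType_one {f : Poly} {t d : ℂ} {R : Poly}
    (H : HasDoubleTangent f t d R) (hs : IsSmoothAt (strictTransform (some t) f) 0) :
    IsEvenType f 1 := by
  refine ⟨blowDown t 0, isSmoothAt_blowDown t 0, fun γ hγ => ?_⟩
  by_cases h : coeff 1 (γ 1) = t * coeff 1 (γ 0)
  · obtain ⟨h0, b, hb, h1⟩ := exists_eq_mul_of_tangent hγ h
    rw [H.order_of_tangent h0 h1, order_blowDown_of_tangent h0 h1]
    obtain ⟨W, hW⟩ := H.strictTransform_eq
    have hb0 : constantCoeff b = 0 := hb.1 1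
    -- The term in `X 1 ^ 2` has no linear part, so smoothness rests on `W` alone.
    have hW0 : eval 0 W ≠ 0 := by
      obtain ⟨hd0, hd1⟩ := pderiv_eval_of_decomposition (P := 0)
        (p := strictTransform (some t) f) (q₀ := W) (q₁ := C d * X 1)
        (by rw [hs.1, hW]; simp; ring)
      obtain ⟨-, i, hi⟩ := hs
      fin_cases i
      · rwa [← hd0]
      · exfalso
        apply hi
        simp only [Fin.mk_one]
        rw [hd1, map_mul, eval_X]
        simp
    have hone : (aeval ![γ 0, b] (strictTransform (some t) f)).order = 1 := by
      rw [order_eq_one_iff, constantCoeff_aeval hb]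
      refine ⟨hs.1, ?_⟩
      rw [hW, map_add, map_mul, map_mul, map_pow, aeval_X, aeval_X, aeval_C, map_add, coeff_one_mul,
        coeff_one_mul, constantCoeff_aeval hb]
      simp only [Matrix.cons_val_zero, Matrix.cons_val_one, Matrix.cons_val_fin_one, pow_two,
        coeff_one_mul, hb0, map_mul, (order_eq_one_iff.1 h0).1]
      simp only [mul_zero, zero_mul, add_zero, zero_add]
      exact mul_ne_zero (order_eq_one_iff.1 h0).2 hW0
    have hb1 : 1 ≤ (b - Polynomial.aeval (γ 0) (0 : Polynomial ℂ)).order := by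
      rw [one_le_order_iff_constCoeff_eq_zero]
      simpa using hb0
    rw [hone]
    generalize (b - Polynomial.aeval (γ 0) (0 : Polynomial ℂ)).order = e at hb1
    induction e using ENat.recTopCoe <;> simp at hb1 ⊢ <;> norm_cast at hb1 ⊢ <;> omega
  · rw [H.order_of_transversal hγ h, order_blowDown_of_transversal hγ (by simp) h]
    rfl

/-- The exceptional line is used as a test arc. Order 2 along it forces the germs governing the
strict transform to be transversal to it, hence graphs over `X 0`; it also bounds the multiplicity
of the strict transform by 2. -/
theorem order_along_exceptional {g : Poly} {d : ℂ} {W : Poly} (hd : d ≠ 0)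
    (hg : g = C d * X 1 ^ 2 + X 0 * W) :
    (aeval ![(0 : ℂ⟦X⟧), PowerSeries.X] g).order = 2 := by
  rw [hg, map_add, map_mul, map_mul, map_pow, aeval_X, aeval_X, aeval_C]
  simp only [Matrix.cons_val_zero, Matrix.cons_val_one, Matrix.cons_val_fin_one, zero_mul,
    add_zero]
  rw [order_mul, order_zero_of_unit ((isUnit_iff_ne_zero.2 hd).map (algebraMap ℂ ℂ⟦X⟧)),
    order_X_pow, zero_add]
  rfl

theorem isArc_exceptional : IsArc ![(0 : ℂ⟦X⟧), PowerSeries.X] :=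
  ⟨fun i => by fin_cases i <;> simp, 1, by simp⟩

theorem pderiv_one_ne_zero {h : Poly} (h0 : eval 0 h = 0)
    (ho : (aeval ![(0 : ℂ⟦X⟧), PowerSeries.X] h).order = 1) : eval 0 (pderiv 1 h) ≠ 0 := by
  obtain ⟨q₀, q₁, hq⟩ := exists_linear_decomposition 0 h
  rw [(pderiv_eval_of_decomposition hq).2]
  have h1 := (order_eq_one_iff.1 ho).2
  rw [hq, h0] at h1
  simpa [coeff_one_mul, constantCoeff_aeval isArc_exceptional] using h1

theorem HasDoubleTangent.isEvenType_succ {f : Poly} {t d : ℂ} {R : Poly}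
    (H : HasDoubleTangent f t d R) {n : ℕ} (hg : IsEvenType (strictTransform (some t) f) n) :
    IsEvenType f (n + 1) := by
  obtain ⟨h', hs, hh⟩ := hg
  obtain ⟨W, hW⟩ := H.strictTransform_eq
  have hexc := hh _ isArc_exceptional
  rw [order_along_exceptional H.ne hW] at hexc
  -- Precision n+1 is what `two_add_min_eq` requires.
  obtain ⟨p, hp, hp'⟩ := exists_graph_approximation hs.1
    (pderiv_one_ne_zero hs.1 (order_eq_one_of_two_mul hexc)) (n + 1)
  refine ⟨blowDown t p, isSmoothAt_blowDown t p, fun γ hγ => ?_⟩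
  by_cases h : coeff 1 (γ 1) = t * coeff 1 (γ 0)
  · obtain ⟨h0, b, hb, h1⟩ := exists_eq_mul_of_tangent hγ h
    rw [H.order_of_tangent h0 h1, order_blowDown_of_tangent h0 h1, hh _ hb]
    exact two_add_min_eq (hp' _ hb)
  · rw [H.order_of_transversal hγ h, order_blowDown_of_transversal hγ hp h]
    norm_cast

theorem HasDoubleTangent.isOddType_succ {f : Poly} {t d : ℂ} {R : Poly}
    (H : HasDoubleTangent f t d R) {n : ℕ} (hg : IsOddType (strictTransform (some t) f) n) :
    IsOddType f (n + 1) := by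
  obtain ⟨hn, h₁, h₂, hs₁, hs₂, hh⟩ := hg
  obtain ⟨W, hW⟩ := H.strictTransform_eq
  have hexc := (hh _ isArc_exceptional).2
  rw [order_along_exceptional H.ne hW] at hexc
  obtain ⟨e₁, e₂⟩ := order_eq_one_of_add hn (one_le_order_aeval isArc_exceptional hs₁.1)
    (one_le_order_aeval isArc_exceptional hs₂.1) hexc
  obtain ⟨p₁, hp₁, hp₁'⟩ := exists_graph_approximation hs₁.1 (pderiv_one_ne_zero hs₁.1 e₁) (n + 1)
  obtain ⟨p₂, hp₂, hp₂'⟩ := exists_graph_approximation hs₂.1 (pderiv_one_ne_zero hs₂.1 e₂) (n + 1)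
  refine ⟨by omega, blowDown t p₁, blowDown t p₂, isSmoothAt_blowDown t p₁,
    isSmoothAt_blowDown t p₂, fun γ hγ => ?_⟩
  by_cases h : coeff 1 (γ 1) = t * coeff 1 (γ 0)
  · obtain ⟨h0, b, hb, h1⟩ := exists_eq_mul_of_tangent hγ h
    rw [H.order_of_tangent h0 h1, order_blowDown_of_tangent h0 h1,
      order_blowDown_of_tangent h0 h1]
    exact contactPair_succ (hp₁' _ hb) (hp₂' _ hb) (hh _ hb).1 (hh _ hb).2
  · rw [H.order_of_transversal hγ h, order_blowDown_of_transversal hγ hp₁ h,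
      order_blowDown_of_transversal hγ hp₂ h]
    -- Along an arc transversal to the tangent both germs have order 1 and `f` has order 2.
    refine ⟨Or.inl ⟨rfl, by norm_cast; omega⟩, ?_⟩
    norm_num

/-! ### Resolution and behaviour along arcs -/

/-- `f` vanishes to order at least two at the origin. -/
def IsSingularO (f : Poly) : Prop :=
  ∃ (a b d : ℂ) (R : Poly), R ∈ idealOfVars (Fin 2) ℂ ^ 3 ∧ f = quad a b d + R

theorem IsSingularO.swap {f : Poly} (h : IsSingularO f) : IsSingularO (swap f) := by
  obtain ⟨a, b, d, R, hR, hf⟩ := h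
  exact ⟨d, b, a, _, swap_mem hR, by rw [hf, map_add, swap_quad]⟩

theorem IsSingularO.not_isSmoothAt {f : Poly} (h : IsSingularO f) : ¬ IsSmoothAt f 0 := by
  obtain ⟨a, b, d, R, hR, hf⟩ := h
  have hX : ∀ i : Fin 2, (X i : Poly) ∈ idealOfVars (Fin 2) ℂ := fun i =>
    Ideal.subset_span ⟨i, rfl⟩
  have hmem : f ∈ idealOfVars (Fin 2) ℂ ^ 2 := by
    rw [hf, quad]
    refine Ideal.add_mem _ (Ideal.add_mem _ (Ideal.add_mem _ ?_ ?_) ?_)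
      (Ideal.pow_le_pow_right (by norm_num) hR)
    · exact Ideal.mul_mem_left _ _ (Ideal.pow_mem_pow (hX 0) 2)
    · rw [pow_two]
      exact Ideal.mul_mem_left _ _ (Ideal.mul_mem_mul (hX 0) (hX 1))
    · exact Ideal.mul_mem_left _ _ (Ideal.pow_mem_pow (hX 1) 2)
  have hcoeff : ∀ γ, IsArc γ → coeff 1 (aeval γ f) = 0 := fun γ hγ =>
    coeff_of_lt_order 1 (lt_of_lt_of_le (by norm_num) (le_order_aeval_of_mem hγ hmem))
  intro hs
  obtain ⟨p, q, hpq, hne⟩ := isSmoothAt_zero_iff.1 hs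
  have a₁ : IsArc ![(PowerSeries.X : ℂ⟦X⟧), 0] :=
    ⟨fun i => by fin_cases i <;> simp, 0, by simp⟩
  have h1 := hcoeff _ a₁
  have h2 := hcoeff _ isArc_exceptional
  rw [hpq, map_add, map_mul, map_mul, map_add, coeff_one_mul, coeff_one_mul] at h1 h2
  simp only [aeval_X, Matrix.cons_val_zero, Matrix.cons_val_one, Matrix.cons_val_fin_one,
    map_zero, zero_mul, add_zero, zero_add, PowerSeries.coeff_one_X, one_mul,
    PowerSeries.constantCoeff_X] at h1 h2
  rw [constantCoeff_aeval a₁] at h1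
  rw [constantCoeff_aeval isArc_exceptional] at h2
  rcases hne with h | h
  · exact h h1
  · exact h h2

/-- The conclusion, on the behaviour along arcs, for a germ resolved by `n` blow-ups with `k` points
over the origin. -/
def Classified (f : Poly) (n k : ℕ) : Prop :=
  (IsSmoothAt f 0 ∧ n = 0 ∧ k = 1) ∨
    (IsSingularO f ∧ (multO f = 2 → (k = 1 → IsEvenType f n) ∧ (k = 2 → IsOddType f n)))

theorem Classified.of_swap {f : Poly} {n k : ℕ} (h : Classified (swap f) n k) :
    Classified f n k := by
  rcases h with ⟨h, h'⟩ | ⟨h, h'⟩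
  · exact Or.inl ⟨swap_swap f ▸ h.swap, h'⟩
  · refine Or.inr ⟨swap_swap f ▸ h.swap, fun hm => ?_⟩
    obtain ⟨h1, h2⟩ := h' (multO_swap hm)
    exact ⟨fun hk => (h1 hk).of_swap, fun hk => (h2 hk).of_swap⟩

theorem Classified.eq_of_isSmoothAt {f : Poly} {n k : ℕ} (h : Classified f n k)
    (hs : IsSmoothAt f 0) : n = 0 ∧ k = 1 := by
  rcases h with h | h
  · exact h.2
  · exact absurd hs h.1.not_isSmoothAt

theorem HasDoubleTangent.multO_strictTransform {f : Poly} {t d : ℂ} {R : Poly}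
    (H : HasDoubleTangent f t d R) (h : IsSingularO (strictTransform (some t) f)) :
    multO (strictTransform (some t) f) = 2 := by
  obtain ⟨a', b', d', R', hR', hf'⟩ := h
  refine multO_of_expansion hR' hf' fun h0 => ?_
  obtain ⟨W, hW⟩ := H.strictTransform_eq
  have h1 := order_along_exceptional H.ne hW
  rw [hf', h0, zero_add] at h1
  have h2 := le_order_aeval_of_mem isArc_exceptional hR'
  rw [h1] at h2
  exact absurd h2 (by norm_num)

theorem HasDoubleTangent.types {f : Poly} {t d : ℂ} {R : Poly} (H : HasDoubleTangent f t d R)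
    {n k : ℕ} (h : Classified (strictTransform (some t) f) n k) :
    (k = 1 → IsEvenType f (1 + n)) ∧ (k = 2 → IsOddType f (1 + n)) := by
  rcases h with ⟨h, rfl, rfl⟩ | ⟨h, h'⟩
  · exact ⟨fun _ => H.isEvenType_one h, fun h => absurd h (by norm_num)⟩
  · obtain ⟨h1, h2⟩ := h' (H.multO_strictTransform h)
    rw [add_comm]
    exact ⟨fun hk => H.isEvenType_succ (h1 hk), fun hk => H.isOddType_succ (h2 hk)⟩

theorem eval_strictTransform_some {f : Poly} {a b d : ℂ} {R : Poly}
    (hR : R ∈ idealOfVars (Fin 2) ℂ ^ 3) (hf : f = quad a b d + R) (hm : multO f = 2) (t : ℂ) :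
    eval 0 (strictTransform (some t) f) = a + b * t + d * t ^ 2 := by
  obtain ⟨W, hW⟩ := (strictTransform_some hR hf hm t).2
  rw [hW]
  simp

theorem isSmoothAt_strictTransform_some {f : Poly} {a b d : ℂ} {R : Poly}
    (hR : R ∈ idealOfVars (Fin 2) ℂ ^ 3) (hf : f = quad a b d + R) (hm : multO f = 2) {t : ℂ}
    (ht : a + b * t + d * t ^ 2 = 0) (ht' : b + 2 * d * t ≠ 0) :
    IsSmoothAt (strictTransform (some t) f) 0 := by
  obtain ⟨W, hW⟩ := (strictTransform_some hR hf hm t).2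
  refine isSmoothAt_zero_iff.2 ⟨W, C (b + 2 * d * t) + C d * X 1, ?_, Or.inr ?_⟩
  · rw [hW, ht, C_0]
    ring
  · rw [map_add, map_mul, eval_X, eval_C]
    simpa using ht'

/-- The points on the exceptional line are the roots of the tangent quadratic form. Two distinct
roots give two smooth points and end the resolution with one blow-up; a double root gives one point,
to which the induction hypothesis applies. -/
theorem ResolvedBy.classified {f : Poly} {n k : ℕ} (h : ResolvedBy f n k) : Classified f n k := by
  induction h with
  | smooth f hf => exact Or.inl ⟨hf, rfl, rfl⟩
  | blowUp f hf S hS n k h ih =>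
    refine Or.inr ⟨exists_expansion_of_two_le hf, fun hm => ?_⟩
    obtain ⟨a, b, d, R, hR, hexp, hne⟩ := exists_expansion_of_multO_eq_two hm
    have hRs := swap_mem hR
    have hexps : PlaneCurve.swap f = quad d b a + PlaneCurve.swap R := by
      rw [hexp, map_add, swap_quad]
    have hms := multO_swap hm
    have hsome : ∀ t, some t ∈ S ↔ a + b * t + d * t ^ 2 = 0 := fun t => by
      rw [hS, eval_strictTransform_some hR hexp hm]
    have hnone : none ∈ S ↔ d = 0 := by
      rw [hS, strictTransform_none hm, eval_zero_swap, eval_strictTransform_some hRs hexps hms]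
      simp
    -- The case `d = 0` is that of a vertical tangent; when it is double, the coordinates are
    -- exchanged.
    by_cases hd : d = 0
    · by_cases hb : b = 0
      · have ha : a ≠ 0 := fun ha => hne (quad_eq_zero_iff.2 ⟨ha, hb, hd⟩)
        have hSe : S = {none} := by
          ext x
          rw [Finset.mem_singleton]
          cases x with
          | none => simp [hnone, hd]
          | some t => simp [hsome, hb, hd, ha]
        have H : HasDoubleTangent (PlaneCurve.swap f) 0 a (PlaneCurve.swap R) :=
          ⟨hRs, by rw [hexps, hb, hd]; simp, ha⟩
        have hc := ih none (hnone.2 hd)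
        rw [strictTransform_none hm] at hc
        obtain ⟨h1, h2⟩ := H.types hc.of_swap
        rw [hSe, Finset.sum_singleton, Finset.sum_singleton]
        exact ⟨fun hk => (h1 hk).of_swap, fun hk => (h2 hk).of_swap⟩
      · have hSe : S = {none, some (-a / b)} := by
          ext x
          rw [Finset.mem_insert, Finset.mem_singleton]
          cases x with
          | none => simp [hnone, hd]
          | some t =>
            simp only [hsome, hd, reduceCtorEq, Option.some.injEq, false_or, zero_mul, add_zero]
            rw [eq_div_iff hb]
            constructor <;> intro h <;> linear_combination h
        have ht : a + b * (-a / b) + d * (-a / b) ^ 2 = 0 := by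
          rw [hd]
          field_simp
          ring
        have hs1 := isSmoothAt_strictTransform_some hR hexp hm ht (by rw [hd]; simpa using hb)
        have hs0 : IsSmoothAt (strictTransform none f) 0 := by
          rw [strictTransform_none hm]
          exact (isSmoothAt_strictTransform_some hRs hexps hms (t := 0) (by simp [hd])
            (by simpa using hb)).swap
        obtain ⟨n1, k1⟩ := (ih _ ((hsome _).2 ht)).eq_of_isSmoothAt hs1
        obtain ⟨n0, k0⟩ := (ih _ (hnone.2 hd)).eq_of_isSmoothAt hs0
        rw [hSe, Finset.sum_pair (by simp), Finset.sum_pair (by simp), n1, n0, k1, k0]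
        refine ⟨fun h => absurd h (by norm_num), fun _ => ?_⟩
        refine isOddType_one hR hexp (a₁ := 1) (b₁ := 0) (a₂ := a) (b₂ := b) ?_ (by simpa using hb)
        simp only [quad, lin, hd, C_0, C_1]
        ring
    · obtain ⟨w, hw⟩ := IsAlgClosed.exists_eq_mul_self (b ^ 2 - 4 * d * a)
      obtain ⟨t₁, t₂, ha, hb⟩ : ∃ t₁ t₂ : ℂ, a = d * t₁ * t₂ ∧ b = -d * (t₁ + t₂) := by
        refine ⟨(-b + w) / (2 * d), (-b - w) / (2 * d), ?_, ?_⟩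
        · field_simp
          linear_combination -hw
        · field_simp
          ring
      have hroot : ∀ t, a + b * t + d * t ^ 2 = 0 ↔ t = t₁ ∨ t = t₂ := fun t => by
        rw [show a + b * t + d * t ^ 2 = d * ((t - t₁) * (t - t₂)) by rw [ha, hb]; ring,
          mul_eq_zero, or_iff_right hd, mul_eq_zero, sub_eq_zero, sub_eq_zero]
      by_cases h12 : t₁ = t₂
      · have hSe : S = {some t₁} := by
          ext x
          rw [Finset.mem_singleton]
          cases x with
          | none => simp [hnone, hd]
          | some t => simp [hsome, hroot, h12]
        have H : HasDoubleTangent f t₁ d R :=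
          ⟨hR, by rw [hexp, ha, hb, ← h12]; congr 2 <;> ring, hd⟩
        have hc := ih (some t₁) ((hsome _).2 ((hroot _).2 (Or.inl rfl)))
        rw [hSe, Finset.sum_singleton, Finset.sum_singleton]
        exact H.types hc
      · have hSe : S = {some t₁, some t₂} := by
          ext x
          rw [Finset.mem_insert, Finset.mem_singleton]
          cases x with
          | none => simp [hnone, hd]
          | some t => simp [hsome, hroot]
        have hr1 := (hroot t₁).2 (Or.inl rfl)
        have hr2 := (hroot t₂).2 (Or.inr rfl)
        have hs1 := isSmoothAt_strictTransform_some hR hexp hm hr1 (by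
          rw [hb, show -d * (t₁ + t₂) + 2 * d * t₁ = d * (t₁ - t₂) by ring]
          exact mul_ne_zero hd (sub_ne_zero.2 h12))
        have hs2 := isSmoothAt_strictTransform_some hR hexp hm hr2 (by
          rw [hb, show -d * (t₁ + t₂) + 2 * d * t₂ = d * (t₂ - t₁) by ring]
          exact mul_ne_zero hd (sub_ne_zero.2 (Ne.symm h12)))
        obtain ⟨n1, k1⟩ := (ih _ ((hsome _).2 hr1)).eq_of_isSmoothAt hs1
        obtain ⟨n2, k2⟩ := (ih _ ((hsome _).2 hr2)).eq_of_isSmoothAt hs2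
        have hne12 : some t₁ ≠ some t₂ := fun h => h12 (Option.some.inj h)
        rw [hSe, Finset.sum_pair hne12, Finset.sum_pair hne12, n1, n2, k1, k2]
        refine ⟨fun h => absurd h (by norm_num), fun _ => ?_⟩
        refine isOddType_one hR hexp (a₁ := -d * t₁) (b₁ := d) (a₂ := -t₂) (b₂ := 1) ?_ ?_
        · simp only [quad, lin, ha, hb, C_mul, C_add, C_neg, C_1]
          ring
        · rw [show -d * t₁ * 1 - -t₂ * d = d * (t₂ - t₁) by ring]
          exact mul_ne_zero hd (sub_ne_zero.2 (Ne.symm h12))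

theorem IsTypeA.isEvenType {f : Poly} {P : Fin 2 → ℂ} {r : ℕ} (h : IsTypeA f P (2 * r)) :
    IsEvenType (translate P f) r := by
  obtain ⟨hm, r', e, he, hs, hres⟩ := h
  obtain ⟨rfl, rfl⟩ : e = 0 ∧ r' = r := by omega
  rcases hres.classified with ⟨hsm, -, -⟩ | ⟨-, hc⟩
  · obtain ⟨a, b, d, R, hR, hf, -⟩ := exists_expansion_of_multO_eq_two hm
    exact absurd hsm (IsSingularO.not_isSmoothAt ⟨a, b, d, R, hR, hf⟩)
  · exact (hc hm).1 rfl

theorem IsTypeA.isOddType {f : Poly} {P : Fin 2 → ℂ} {r : ℕ} (hr : 1 ≤ r)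
    (h : IsTypeA f P (2 * r - 1)) : IsOddType (translate P f) r := by
  obtain ⟨hm, r', e, he, hs, hres⟩ := h
  obtain ⟨rfl, rfl⟩ : e = 1 ∧ r' = r := by omega
  rcases hres.classified with ⟨hsm, -, -⟩ | ⟨-, hc⟩
  · obtain ⟨a, b, d, R, hR, hf, -⟩ := exists_expansion_of_multO_eq_two hm
    exact absurd hsm (IsSingularO.not_isSmoothAt ⟨a, b, d, R, hR, hf⟩)
  · exact (hc hm).2 rfl

/-! ### Translation to the origin -/

theorem eval_zero_translate (P : Fin 2 → ℂ) (f : Poly) : eval 0 (translate P f) = eval P f := by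
  have : (eval 0).comp (aeval fun i => (X i + C (P i) : Poly)).toRingHom = eval P := by
    apply MvPolynomial.ringHom_ext <;> intro i <;> simp
  exact DFunLike.congr_fun this f

theorem translate_translate_neg (P : Fin 2 → ℂ) (f : Poly) :
    translate P (translate (-P) f) = f := by
  have : (aeval fun i => (X i + C (P i) : Poly)).comp
      (aeval fun i => (X i + C ((-P) i) : Poly)) = AlgHom.id ℂ Poly := by
    ext i : 1
    simp
  exact DFunLike.congr_fun this f

theorem translate_zero (f : Poly) : translate 0 f = f := by
  simp [translate]

theorem isSmoothAt_translate {P : Fin 2 → ℂ} {g : Poly} :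
    IsSmoothAt (translate P g) 0 ↔ IsSmoothAt g P := by
  obtain ⟨q₀, q₁, hq⟩ := exists_linear_decomposition P g
  obtain ⟨h0, h1⟩ := pderiv_eval_of_decomposition hq
  have htr := congrArg (translate P) hq
  have hX : ∀ i, translate P (X i - C (P i)) = X i := fun i => by
    simp [translate, algebraMap_eq]
  have hC : ∀ a, translate P (C a) = C a := fun a => by simp [translate, algebraMap_eq]
  have hq' : translate P g = C (eval 0 (translate P g)) + (X 0 - C ((0 : Fin 2 → ℂ) 0)) *
      translate P q₀ + (X 1 - C ((0 : Fin 2 → ℂ) 1)) * translate P q₁ := by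
    rw [eval_zero_translate, ← hC, Pi.zero_apply, Pi.zero_apply, C_0, sub_zero, sub_zero, ← hX 0,
      ← hX 1]
    conv_lhs => rw [hq]
    simp only [translate, map_add, map_mul]
  obtain ⟨k0, k1⟩ := pderiv_eval_of_decomposition hq'
  rw [eval_zero_translate] at k0 k1
  rw [IsSmoothAt, IsSmoothAt, eval_zero_translate, Fin.exists_fin_two, Fin.exists_fin_two, h0, h1,
    k0, k1]

theorem exists_parametrization {P : Fin 2 → ℂ} {g : Poly} (hg : IsSmoothAt g P) :
    ∃ γ, IsArc γ ∧ aeval γ (translate P g) = 0 ∧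
      ∀ f, interMult f g P = (aeval γ (translate P f)).order := by
  obtain ⟨γ, hγ, h0⟩ := exists_arc (isSmoothAt_translate.2 hg)
  refine ⟨γ, hγ, h0, fun f => ?_⟩
  rw [germ_translate] at h0 ⊢
  exact interMult_eq_order hγ hg h0 f

/-! ### Graphs -/

/-- A difference quotient in the second variable. When the derivative is nonzero the quotient is a
unit, so orders along graphs become orders of differences of series. -/
theorem exists_aeval_sub_eq (h : Poly) {x s s' : ℂ⟦X⟧} (hx : constantCoeff x = 0)
    (hs : constantCoeff s = 0) (hs' : constantCoeff s' = 0) :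
    ∃ k, aeval ![x, s] h - aeval ![x, s'] h = (s - s') * k ∧
      constantCoeff k = eval 0 (pderiv 1 h) := by
  have hc : ∀ p : Poly, constantCoeff (aeval ![x, s'] p) = eval 0 p := fun p => by
    induction p using MvPolynomial.induction_on with
    | C a => simp
    | add p q hp hq => rw [map_add, map_add, hp, hq, map_add]
    | mul_X p i hp =>
      rw [map_mul, map_mul, aeval_X, map_mul, eval_X, Pi.zero_apply, mul_zero]
      fin_cases i
      · simp [hx]
      · simp [hs']
  induction h using MvPolynomial.induction_on with
  | C a => exact ⟨0, by simp, by simp⟩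
  | add p q hp hq =>
    obtain ⟨k, hk, hk'⟩ := hp
    obtain ⟨l, hl, hl'⟩ := hq
    refine ⟨k + l, ?_, by rw [map_add, map_add, map_add, hk', hl']⟩
    rw [map_add, map_add]
    linear_combination hk + hl
  | mul_X p i hp =>
    obtain ⟨k, hk, hk'⟩ := hp
    fin_cases i
    · refine ⟨k * x, ?_, ?_⟩
      · simp only [map_mul, aeval_X, Fin.zero_eta, Matrix.cons_val_zero]
        linear_combination x * hk
      · rw [map_mul, hx]
        simp [pderiv_X]
    · refine ⟨k * s + aeval ![x, s'] p, ?_, ?_⟩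
      · simp only [map_mul, aeval_X, Fin.mk_one, Matrix.cons_val_one, Matrix.cons_val_fin_one]
        linear_combination s * hk
      · rw [map_add, map_mul, hs, hc]
        simp [pderiv_X]

theorem order_aeval_graph {h : Poly} (h1 : eval 0 (pderiv 1 h) ≠ 0) {c : ℕ → ℂ} (hc : c 0 = 0)
    (hz : aeval ![PowerSeries.X, mk c] h = 0) {s : ℂ⟦X⟧} (hs : constantCoeff s = 0) :
    (aeval ![PowerSeries.X, s] h).order = (s - mk c).order := by
  obtain ⟨k, hk, hk'⟩ := exists_aeval_sub_eq h (x := PowerSeries.X) (s := s) (s' := mk c)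
    (by simp) hs (by simp [hc])
  rw [hz, sub_zero] at hk
  have hu : IsUnit k := by
    rw [PowerSeries.isUnit_iff_constantCoeff, isUnit_iff_ne_zero, hk']
    exact h1
  rw [hk, order_mul, order_zero_of_unit hu, add_zero]

theorem isArc_graph {s : ℂ⟦X⟧} (hs : constantCoeff s = 0) : IsArc ![PowerSeries.X, s] :=
  ⟨fun i => by fin_cases i <;> simp [hs], 0, by simp⟩

/-! ### The tangents of a double point -/

theorem isTangentO_iff {f : Poly} {a b d : ℂ} {R : Poly} (hm : multO f = 2)
    (hR : R ∈ idealOfVars (Fin 2) ℂ ^ 3) (hf : f = quad a b d + R) (v : Fin 2 → ℂ) :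
    IsTangentO f v ↔ a * v 0 ^ 2 + b * (v 0 * v 1) + d * v 1 ^ 2 = 0 := by
  rw [IsTangentO, hm, homogeneousComponent_two_of_expansion hR hf]
  simp [quad]

theorem order_of_isTangentO {f : Poly} (hm : multO f = 2) {γ} (hγ : IsArc γ) :
    (IsTangentO f (fun i => coeff 1 (γ i)) → 3 ≤ (aeval γ f).order) ∧
      (¬ IsTangentO f (fun i => coeff 1 (γ i)) → (aeval γ f).order = 2) := by
  obtain ⟨a, b, d, R, hR, hf, -⟩ := exists_expansion_of_multO_eq_two hm
  have hmin := min_order_quad hγ hR hf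
  rw [isTangentO_iff hm hR hf]
  choose u hu using fun i => PowerSeries.X_dvd_iff.2 (hγ.1 i)
  have hcu : ∀ i, coeff 1 (γ i) = constantCoeff (u i) := fun i => by
    rw [hu, coeff_one_mul]
    simp
  simp only [hcu]
  set Q : ℂ⟦X⟧ := algebraMap ℂ ℂ⟦X⟧ a * u 0 ^ 2 + algebraMap ℂ ℂ⟦X⟧ b * (u 0 * u 1) +
    algebraMap ℂ ℂ⟦X⟧ d * u 1 ^ 2 with hQ
  have hcQ : constantCoeff Q = a * constantCoeff (u 0) ^ 2 +
      b * (constantCoeff (u 0) * constantCoeff (u 1)) + d * constantCoeff (u 1) ^ 2 := by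
    simp [hQ]
  have hq : (aeval γ (quad a b d)).order = 2 + Q.order := by
    have : aeval γ (quad a b d) = PowerSeries.X ^ 2 * Q := by
      simp only [quad, map_add, map_mul, map_pow, aeval_X, aeval_C]
      rw [hu 0, hu 1, hQ]
      ring
    rw [this, order_mul, order_X_pow]
    rfl
  rw [hq] at hmin
  rw [← hcQ]
  constructor
  · intro h
    rw [← one_le_order_iff_constCoeff_eq_zero] at h
    have h3 : (3 : ℕ∞) ≤ 2 + Q.order :=
      le_trans (by norm_num) (add_le_add_right h (2 : ℕ∞))
    rw [min_eq_right h3] at hmin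
    exact min_eq_right_iff.1 hmin
  · intro h
    have h0 : Q.order = 0 := by
      by_contra hne
      exact h (order_ne_zero_iff_constCoeff_eq_zero.1 hne)
    rw [h0, add_zero] at hmin
    exact order_eq_of_min_eq (hmin.trans (by norm_num))

/-! ### Arithmetic of intersection multiplicities -/

theorem exists_even_of_min {r : ℕ} {e p : ℕ∞} (h : e = min (2 * p) ((2 * r + 1 : ℕ) : ℕ∞))
    (he : e ≤ ((2 * r : ℕ) : ℕ∞)) : ∃ k : ℕ, e = ((2 * k : ℕ) : ℕ∞) := by
  rcases min_choice (2 * p) ((2 * r + 1 : ℕ) : ℕ∞) with h' | h' <;> rw [h'] at h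
  · induction p using ENat.recTopCoe with
    | top =>
      rw [h, show (2 : ℕ∞) * ⊤ = ⊤ from rfl] at he
      exact absurd (top_le_iff.1 he) (ENat.natCast_ne_top _)
    | coe p => exact ⟨p, by rw [h]; norm_cast⟩
  · rw [h] at he
    norm_cast at he
    omega

/-- If the orders differed, one would be r and the other larger, making the sum exceed 2r. -/
theorem ContactPair.eq_of_add_le {r : ℕ} {p q : ℕ∞} (hpq : ContactPair r p q)
    (h : p + q ≤ ((2 * r : ℕ) : ℕ∞)) : p = q := by
  unfold ContactPair at hpq
  induction p using ENat.recTopCoe <;> induction q using ENat.recTopCoe <;>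
    simp at hpq h ⊢ <;> norm_cast at hpq h ⊢ <;> omega

theorem exists_even_of_contactPair {r : ℕ} {e p q : ℕ∞} (hpq : ContactPair r p q)
    (h : min e ((2 * r + 1 : ℕ) : ℕ∞) = min (p + q) ((2 * r + 1 : ℕ) : ℕ∞))
    (he : e ≤ ((2 * r : ℕ) : ℕ∞)) : ∃ k : ℕ, e = ((2 * k : ℕ) : ℕ∞) := by
  have hlt : e < ((2 * r + 1 : ℕ) : ℕ∞) := lt_of_le_of_lt he (by norm_cast; omega)
  rw [min_eq_left hlt.le] at h
  have hs : e = p + q := by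
    rcases min_choice (p + q) ((2 * r + 1 : ℕ) : ℕ∞) with h' | h' <;> rw [h'] at h
    · exact h
    · exact absurd h hlt.ne
  have hp := hpq.eq_of_add_le (hs ▸ he)
  subst hp
  refine exists_even_of_min (r := r) (p := p) ?_ he
  rw [two_mul, ← hs, min_eq_left hlt.le]

theorem ContactPair.eq_of_top {r : ℕ} {q : ℕ∞} (h : ContactPair r ⊤ q) : q = r := by
  simpa [ContactPair] using h

theorem ContactPair.symm {r : ℕ} {p q : ℕ∞} (h : ContactPair r p q) : ContactPair r q p := by
  rcases h with ⟨rfl, h⟩ | h | h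
  · exact Or.inl ⟨rfl, h⟩
  · exact Or.inr (Or.inr h.symm)
  · exact Or.inr (Or.inl h.symm)

theorem lt_or_lt_of_le_add {r : ℕ} {p q : ℕ∞}
    (h : ((2 * r + 1 : ℕ) : ℕ∞) ≤ p + q) : (r : ℕ∞) < p ∨ (r : ℕ∞) < q := by
  by_contra! hn
  have := h.trans (add_le_add hn.1 hn.2)
  norm_cast at this
  omega

theorem le_of_min_eq_min {N e s : ℕ∞} (h : min e N = min s N) : N ≤ e ↔ N ≤ s := by
  rw [← min_eq_right_iff, h, min_eq_right_iff]

theorem lt_of_le_min_two_mul {r : ℕ} {p : ℕ∞} (h : ((2 * r + 1 : ℕ) : ℕ∞) ≤ 2 * p) :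
    (r : ℕ∞) < p := by
  by_contra! hn
  have := h.trans (mul_le_mul_right hn (2 : ℕ∞))
  norm_cast at this
  omega

/-! ### Smooth germs with high contact -/

theorem exists_contact_of_isEvenType {f : Poly} {P : Fin 2 → ℂ} {r : ℕ}
    (H : IsEvenType (translate P f) r) :
    (∀ g, IsSmoothAt g P → interMult f g P ≤ ((2 * r + 1 : ℕ) : ℕ∞)) ∧
      (∃ g, IsSmoothAt g P ∧ interMult f g P = ((2 * r + 1 : ℕ) : ℕ∞)) ∧
      ∀ g₁ g₂, IsSmoothAt g₁ P → IsSmoothAt g₂ P →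
        interMult f g₁ P = ((2 * r + 1 : ℕ) : ℕ∞) → interMult f g₂ P = ((2 * r + 1 : ℕ) : ℕ∞) →
        (r : ℕ∞) < interMult g₁ g₂ P := by
  obtain ⟨h, hs, hh⟩ := H
  refine ⟨fun g hg => ?_, ⟨translate (-P) h, ?_, ?_⟩, fun g₁ g₂ hg₁ hg₂ he₁ he₂ => ?_⟩
  · obtain ⟨γ, hγ, -, hi⟩ := exists_parametrization hg
    rw [hi, hh γ hγ]
    exact min_le_right _ _
  · rwa [← isSmoothAt_translate, translate_translate_neg]
  · obtain ⟨γ, hγ, h0, hi⟩ := exists_parametrization (P := P) (g := translate (-P) h)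
      (by rwa [← isSmoothAt_translate, translate_translate_neg])
    rw [translate_translate_neg] at h0
    rw [hi, hh γ hγ, h0]
    simp
  · obtain ⟨γ₁, hγ₁, h₁, hi₁⟩ := exists_parametrization hg₁
    obtain ⟨γ₂, hγ₂, h₂, hi₂⟩ := exists_parametrization hg₂
    obtain ⟨γ, hγ, h0⟩ := exists_arc hs
    rw [hi₁, hh _ hγ₁, min_eq_right_iff] at he₁
    rw [hi₂, hh _ hγ₂, min_eq_right_iff] at he₂
    -- Since 2 ord h ≥ 2r+1, each curve has contact at least r+1 with `h`, and therefore with the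
    -- other curve.
    have k₁ := Order.add_one_le_of_lt (lt_of_le_min_two_mul he₁)
    have k₂ := Order.add_one_le_of_lt (lt_of_le_min_two_mul he₂)
    have := min_order_eq_of_contact hγ₁ hγ hγ₂ (isSmoothAt_translate.2 hg₁) h₁ hs h0
      (n := r + 1) (by exact_mod_cast k₁)
    rw [hi₂ g₁]
    have k₃ := (le_of_min_eq_min this).2 (by exact_mod_cast k₂)
    exact lt_of_lt_of_le (by exact_mod_cast Nat.lt_succ_self r) k₃

theorem exists_contact_of_isOddType {f : Poly} {P : Fin 2 → ℂ} {r : ℕ}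
    (H : IsOddType (translate P f) r) :
    ∃ g₁ g₂, IsSmoothAt g₁ P ∧ IsSmoothAt g₂ P ∧
      ((2 * r + 1 : ℕ) : ℕ∞) ≤ interMult f g₁ P ∧ ((2 * r + 1 : ℕ) : ℕ∞) ≤ interMult f g₂ P ∧
      interMult g₁ g₂ P = r := by
  obtain ⟨-, h₁, h₂, hs₁, hs₂, hh⟩ := H
  have hg₁ : IsSmoothAt (translate (-P) h₁) P := by
    rwa [← isSmoothAt_translate, translate_translate_neg]
  have hg₂ : IsSmoothAt (translate (-P) h₂) P := by
    rwa [← isSmoothAt_translate, translate_translate_neg]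
  obtain ⟨γ₁, hγ₁, z₁, hi₁⟩ := exists_parametrization hg₁
  obtain ⟨γ₂, hγ₂, z₂, hi₂⟩ := exists_parametrization hg₂
  rw [translate_translate_neg] at z₁ z₂
  obtain ⟨c₁, e₁⟩ := hh _ hγ₁
  obtain ⟨c₂, e₂⟩ := hh _ hγ₂
  rw [z₁, order_zero] at c₁ e₁
  rw [z₂, order_zero] at c₂ e₂
  refine ⟨_, _, hg₁, hg₂, ?_, ?_, ?_⟩
  · rw [hi₁, le_of_min_eq_min e₁]
    simp
  · rw [hi₂, le_of_min_eq_min e₂]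
    simp
  · rw [hi₂, translate_translate_neg]
    exact c₂.symm.eq_of_top

/-! ### Local equations -/

theorem not_isTangentO_of_vertical {f : Poly} (hm : multO f = 2) (hv : ¬ IsTangentO f ![0, 1])
    {v : Fin 2 → ℂ} (h0 : v 0 = 0) (h1 : v 1 ≠ 0) : ¬ IsTangentO f v := by
  obtain ⟨a, b, d, R, hR, hf, -⟩ := exists_expansion_of_multO_eq_two hm
  rw [isTangentO_iff hm hR hf] at hv ⊢
  simpa [h0, h1] using hv

theorem order_vertical {f : Poly} (hm : multO f = 2) (hv : ¬ IsTangentO f ![0, 1]) :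
    (aeval ![(0 : ℂ⟦X⟧), PowerSeries.X] f).order = 2 :=
  (order_of_isTangentO hm isArc_exceptional).2
    (not_isTangentO_of_vertical hm hv (by simp) (by simp))

theorem interMult_eq_order_graph {g : Poly} (hg : IsSmoothAt g 0) {c : ℕ → ℂ} (hc : c 0 = 0)
    (hz : aeval ![PowerSeries.X, mk c] g = 0) (f : Poly) :
    interMult f g 0 = (aeval ![PowerSeries.X, mk c] f).order := by
  have harc : IsArc ![PowerSeries.X, mk c] := isArc_graph (by simpa using hc)
  rw [← germ_zero] at hz ⊢
  exact interMult_eq_order harc hg hz f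

/-- A smooth germ with contact at least three is transversal to the `y`-axis. -/
theorem exists_localEquation_of_contact {f g : Poly} (hm : multO f = 2)
    (hv : ¬ IsTangentO f ![0, 1]) (hg : IsSmoothAt g 0) (h3 : 3 ≤ interMult f g 0) :
    ∃ c : ℕ → ℂ, c 0 = 0 ∧ HasLocalEquation g c ∧ aeval ![PowerSeries.X, mk c] g = 0 ∧
      interMult f g 0 = (aeval ![PowerSeries.X, mk c] f).order := by
  -- A germ with vanishing y-derivative has a vertical tangent, which is not tangent to `f`, and
  -- would meet `f` with multiplicity 2 only.
  have h1 : eval 0 (pderiv 1 g) ≠ 0 := by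
    intro h1
    obtain ⟨γ, hγ, h0, hi⟩ := exists_parametrization hg
    rw [translate_zero] at h0
    obtain ⟨q₀, q₁, hq⟩ := exists_linear_decomposition 0 g
    obtain ⟨k0, k1⟩ := pderiv_eval_of_decomposition hq
    have hg0 : eval 0 (pderiv 0 g) ≠ 0 := by
      obtain ⟨-, i, hi⟩ := hg
      fin_cases i
      · exact hi
      · exact absurd h1 hi
    rw [hq, hg.1] at h0
    have hc := congrArg (coeff 1) h0
    have e0 : ∀ i, aeval γ (X i - C ((0 : Fin 2 → ℂ) i) : Poly) = γ i := fun i => by simp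
    rw [C_0, zero_add, map_add, map_mul, map_mul, e0, e0, map_add, coeff_one_mul, coeff_one_mul,
      constantCoeff_aeval hγ, constantCoeff_aeval hγ, ← k0, ← k1, h1, hγ.1, hγ.1] at hc
    simp only [zero_mul, zero_add, mul_zero, add_zero, map_zero, mul_eq_zero, or_iff_left hg0]
      at hc
    have hc1 : coeff 1 (γ 1) ≠ 0 := by
      obtain ⟨i, hi⟩ := hγ.2
      fin_cases i
      · exact absurd hc hi
      · exact hi
    have h2 := (order_of_isTangentO hm hγ).2 (not_isTangentO_of_vertical hm hv hc hc1)
    rw [hi, translate_zero, h2] at h3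
    exact absurd h3 (by norm_num)
  obtain ⟨c, hc, hloc, hz⟩ := exists_hasLocalEquation hg.1 h1
  exact ⟨c, hc, hloc, hz, interMult_eq_order_graph hg hc hz f⟩

theorem isTangentO_line {f : Poly} (hm : multO f = 2) (t : ℂ) :
    IsTangentO f ![1, t] ↔
      3 ≤ (aeval ![PowerSeries.X, algebraMap ℂ ℂ⟦X⟧ t * PowerSeries.X] f).order := by
  have harc : IsArc ![PowerSeries.X, algebraMap ℂ ℂ⟦X⟧ t * PowerSeries.X] :=
    isArc_graph (by simp)
  have hv : (fun i => coeff 1 ((![PowerSeries.X, algebraMap ℂ ℂ⟦X⟧ t * PowerSeries.X] :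
      Fin 2 → ℂ⟦X⟧) i)) = ![1, t] := by
    ext i
    fin_cases i <;> simp
  have h := order_of_isTangentO hm harc
  rw [hv] at h
  refine ⟨h.1, fun h3 => ?_⟩
  by_contra hn
  rw [h.2 hn] at h3
  exact absurd h3 (by norm_num)

theorem two_le_order_line_iff {h : Poly} (h1 : eval 0 (pderiv 1 h) ≠ 0) {c : ℕ → ℂ}
    (hc : c 0 = 0) (hz : aeval ![PowerSeries.X, mk c] h = 0) (t : ℂ) :
    2 ≤ (aeval ![PowerSeries.X, algebraMap ℂ ℂ⟦X⟧ t * PowerSeries.X] h).order ↔ t = c 1 := by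
  rw [order_aeval_graph h1 hc hz (by simp)]
  have e1 : coeff 1 (algebraMap ℂ ℂ⟦X⟧ t * PowerSeries.X - mk c) = t - c 1 := by simp
  constructor
  · intro h2
    have := coeff_of_lt_order 1 (lt_of_lt_of_le (by norm_num) h2)
    rwa [e1, sub_eq_zero] at this
  · rintro rfl
    refine nat_le_order _ 2 fun i hi => ?_
    interval_cases i
    · simp [hc]
    · simp

theorem coeff_eq_of_lt_order {h : Poly} (h1 : eval 0 (pderiv 1 h) ≠ 0) {c c' : ℕ → ℂ}
    (hc : c 0 = 0) (hz : aeval ![PowerSeries.X, mk c] h = 0) (hc' : c' 0 = 0) {r : ℕ}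
    (hr : (r : ℕ∞) < (aeval ![PowerSeries.X, mk c'] h).order) : ∀ i ≤ r, c' i = c i := by
  intro i hi
  rw [order_aeval_graph h1 hc hz (by simp [hc'])] at hr
  have := coeff_of_lt_order i (lt_of_le_of_lt (by exact_mod_cast hi) hr)
  simpa [sub_eq_zero] using this

theorem three_le_min_iff {r : ℕ} (hr : 1 ≤ r) {p : ℕ∞} :
    3 ≤ min (2 * p) ((2 * r + 1 : ℕ) : ℕ∞) ↔ 2 ≤ p := by
  induction p using ENat.recTopCoe <;> simp <;> norm_cast <;> omega

/-- Contact at least 2 means that the two germs share their tangent, so the tangent of `f` can be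
read off from one of them. -/
theorem ContactPair.three_le_iff {r : ℕ} (hr : 2 ≤ r) {p q : ℕ∞} (hpq : ContactPair r p q)
    (hq : 1 ≤ q) : 3 ≤ p + q ↔ 2 ≤ p := by
  unfold ContactPair at hpq
  induction p using ENat.recTopCoe <;> induction q using ENat.recTopCoe <;>
    simp at hpq hq ⊢ <;> norm_cast at hpq hq ⊢ <;> omega

/-- The sequence is the expansion of the germ `h`, which the vertical test arc shows to be
transversal to the y-axis. -/
theorem localEquation_of_isEvenType {f : Poly} {r : ℕ} (hr : 1 ≤ r) (hm : multO f = 2)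
    (H : IsEvenType f r) (hv : ¬ IsTangentO f ![0, 1]) :
    ∃ γ : ℕ → ℂ, γ 0 = 0 ∧ (∀ t : ℂ, IsTangentO f ![1, t] ↔ t = γ 1) ∧
      ∀ g : Poly, IsSmoothAt g 0 → ((2 * r + 1 : ℕ) : ℕ∞) ≤ interMult f g 0 →
        ∃ c : ℕ → ℂ, HasLocalEquation g c ∧ ∀ i ≤ r, c i = γ i := by
  obtain ⟨h, hs, hh⟩ := H
  have hexc := hh _ isArc_exceptional
  rw [order_vertical hm hv] at hexc
  have h1 := pderiv_one_ne_zero hs.1 (order_eq_one_of_two_mul hexc)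
  obtain ⟨c, hc, -, hz⟩ := exists_hasLocalEquation hs.1 h1
  refine ⟨c, hc, fun t => ?_, fun g hg he => ?_⟩
  · rw [isTangentO_line hm, hh _ (isArc_graph (by simp)), three_le_min_iff hr,
      two_le_order_line_iff h1 hc hz]
  · obtain ⟨c', hc', hloc, -, hi⟩ := exists_localEquation_of_contact hm hv hg
      (le_trans (by norm_cast; omega) he)
    refine ⟨c', hloc, ?_⟩
    rw [hi, hh _ (isArc_graph (by simp [hc'])), le_min_iff] at he
    exact coeff_eq_of_lt_order h1 hc hz hc' (lt_of_le_min_two_mul he.1)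

theorem localEquation_of_isOddType {f : Poly} {r : ℕ} (hr : 2 ≤ r) (hm : multO f = 2)
    (H : IsOddType f r) (hv : ¬ IsTangentO f ![0, 1]) :
    ∃ γ : ℕ → ℂ, γ 0 = 0 ∧ (∀ t : ℂ, IsTangentO f ![1, t] ↔ t = γ 1) ∧
      ∃ a b : ℂ, a ≠ b ∧
        (∀ g : Poly, IsSmoothAt g 0 → ((2 * r + 1 : ℕ) : ℕ∞) ≤ interMult f g 0 →
          ∃ c : ℕ → ℂ, HasLocalEquation g c ∧ (∀ i < r, c i = γ i) ∧ (c r = a ∨ c r = b)) ∧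
        (∀ z : ℂ, z = a ∨ z = b → ∃ g : Poly, IsSmoothAt g 0 ∧
          ((2 * r + 1 : ℕ) : ℕ∞) ≤ interMult f g 0 ∧
          ∃ c : ℕ → ℂ, HasLocalEquation g c ∧ c r = z) := by
  obtain ⟨hr1, h₁, h₂, hs₁, hs₂, hh⟩ := H
  have hexc := (hh _ isArc_exceptional).2
  rw [order_vertical hm hv] at hexc
  obtain ⟨e₁, e₂⟩ := order_eq_one_of_add hr1 (one_le_order_aeval isArc_exceptional hs₁.1)
    (one_le_order_aeval isArc_exceptional hs₂.1) hexc
  have d₁ := pderiv_one_ne_zero hs₁.1 e₁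
  have d₂ := pderiv_one_ne_zero hs₂.1 e₂
  obtain ⟨c₁, hc₁, hl₁, hz₁⟩ := exists_hasLocalEquation hs₁.1 d₁
  obtain ⟨c₂, hc₂, hl₂, hz₂⟩ := exists_hasLocalEquation hs₂.1 d₂
  have a₁ := isArc_graph (s := mk c₁) (by simp [hc₁])
  have a₂ := isArc_graph (s := mk c₂) (by simp [hc₂])
  have k₁ := hh _ a₁
  have k₂ := hh _ a₂
  rw [hz₁, order_zero] at k₁
  rw [hz₂, order_zero] at k₂
  have hord := k₁.1.eq_of_top
  -- Contact exactly r between `h₁` and `h₂`: their expansions agree below index r and differ at r.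
  rw [order_aeval_graph d₂ hc₂ hz₂ (by simp [hc₁]), order_eq_nat] at hord
  simp only [map_sub, coeff_mk, sub_eq_zero] at hord
  refine ⟨c₁, hc₁, fun t => ?_, c₁ r, c₂ r, sub_ne_zero.1 hord.1, fun g hg he => ?_, ?_⟩
  · have ht := isArc_graph (s := algebraMap ℂ ℂ⟦X⟧ t * PowerSeries.X) (by simp)
    obtain ⟨hp, hp'⟩ := hh _ ht
    have hle : (3 : ℕ∞) ≤ ((2 * r + 1 : ℕ) : ℕ∞) := by norm_cast; omega
    rw [isTangentO_line hm, ← two_le_order_line_iff d₁ hc₁ hz₁,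
      ← hp.three_le_iff hr (one_le_order_aeval ht hs₂.1)]
    constructor
    · intro h
      exact (le_min h hle).trans (hp'.le.trans (min_le_left _ _))
    · intro h
      exact (le_min h hle).trans (hp'.ge.trans (min_le_left _ _))
  · obtain ⟨c, hc, hloc, -, hi⟩ := exists_localEquation_of_contact hm hv hg
      (le_trans (by norm_cast; omega) he)
    refine ⟨c, hloc, ?_⟩
    obtain ⟨hp, hp'⟩ := hh _ (isArc_graph (s := mk c) (by simp [hc]))
    rw [hi, le_of_min_eq_min hp'] at he
    -- The curve has contact greater than r with one of the two germs and copies its coefficients up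
    -- to index r.
    rcases lt_or_lt_of_le_add he with h | h
    · have := coeff_eq_of_lt_order d₁ hc₁ hz₁ hc h
      exact ⟨fun i hi => this i hi.le, Or.inl (this r le_rfl)⟩
    · have := coeff_eq_of_lt_order d₂ hc₂ hz₂ hc h
      exact ⟨fun i hi => (this i hi.le).trans (hord.2 i hi).symm, Or.inr (this r le_rfl)⟩
  · rintro z (rfl | rfl)
    · refine ⟨h₁, hs₁, ?_, c₁, hl₁, rfl⟩
      rw [interMult_eq_order_graph hs₁ hc₁ hz₁, le_of_min_eq_min k₁.2]
      simp
    · refine ⟨h₂, hs₂, ?_, c₂, hl₂, rfl⟩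
      rw [interMult_eq_order_graph hs₂ hc₂ hz₂, le_of_min_eq_min k₂.2]
      simp

theorem IsTypeA.multO_eq {f : Poly} {s : ℕ} (h : IsTypeA f 0 s) : multO f = 2 := by
  have := h.1
  rwa [IsDoublePoint, translate_zero] at this

end PlaneCurve

end

/-! ### Assembly of the four statements -/

theorem proposition2p2 (f : PlaneCurve.Poly) (hf : Squarefree f) (r : ℕ) (hr : 1 ≤ r) :
    -- (i)
    (∀ P : Fin 2 → ℂ, (PlaneCurve.IsTypeA f P (2 * r - 1) ∨ PlaneCurve.IsTypeA f P (2 * r)) →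
      ∀ g : PlaneCurve.Poly, PlaneCurve.IsSmoothAt g P →
        PlaneCurve.interMult f g P ≤ ((2 * r : ℕ) : ℕ∞) →
        ∃ k : ℕ, PlaneCurve.interMult f g P = ((2 * k : ℕ) : ℕ∞)) ∧
    -- (ii)
    (∀ P : Fin 2 → ℂ, PlaneCurve.IsTypeA f P (2 * r - 1) →
      ∃ g₁ g₂ : PlaneCurve.Poly, PlaneCurve.IsSmoothAt g₁ P ∧ PlaneCurve.IsSmoothAt g₂ P ∧
        ((2 * r + 1 : ℕ) : ℕ∞) ≤ PlaneCurve.interMult f g₁ P ∧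
        ((2 * r + 1 : ℕ) : ℕ∞) ≤ PlaneCurve.interMult f g₂ P ∧
        PlaneCurve.interMult g₁ g₂ P = (r : ℕ∞)) ∧
    -- (iii)
    (∀ P : Fin 2 → ℂ, PlaneCurve.IsTypeA f P (2 * r) →
      (∀ g : PlaneCurve.Poly, PlaneCurve.IsSmoothAt g P →
        PlaneCurve.interMult f g P ≤ ((2 * r + 1 : ℕ) : ℕ∞)) ∧
      (∃ g : PlaneCurve.Poly, PlaneCurve.IsSmoothAt g P ∧
        PlaneCurve.interMult f g P = ((2 * r + 1 : ℕ) : ℕ∞)) ∧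
      (∀ g₁ g₂ : PlaneCurve.Poly, PlaneCurve.IsSmoothAt g₁ P → PlaneCurve.IsSmoothAt g₂ P →
        PlaneCurve.interMult f g₁ P = ((2 * r + 1 : ℕ) : ℕ∞) →
        PlaneCurve.interMult f g₂ P = ((2 * r + 1 : ℕ) : ℕ∞) →
        (r : ℕ∞) < PlaneCurve.interMult g₁ g₂ P)) ∧
    -- (iv), type `A_{2r}`
    (PlaneCurve.IsTypeA f 0 (2 * r) → ¬ PlaneCurve.IsTangentO f ![0, 1] →
      ∃ γ : ℕ → ℂ, γ 0 = 0 ∧ (∀ t : ℂ, PlaneCurve.IsTangentO f ![1, t] ↔ t = γ 1) ∧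
        ∀ g : PlaneCurve.Poly, PlaneCurve.IsSmoothAt g 0 →
          ((2 * r + 1 : ℕ) : ℕ∞) ≤ PlaneCurve.interMult f g 0 →
          ∃ c : ℕ → ℂ, PlaneCurve.HasLocalEquation g c ∧ ∀ i ≤ r, c i = γ i) ∧
    -- (iv), type `A_{2r-1}`
    (2 ≤ 2 * r - 1 → PlaneCurve.IsTypeA f 0 (2 * r - 1) → ¬ PlaneCurve.IsTangentO f ![0, 1] →
      ∃ γ : ℕ → ℂ, γ 0 = 0 ∧ (∀ t : ℂ, PlaneCurve.IsTangentO f ![1, t] ↔ t = γ 1) ∧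
        ∃ a b : ℂ, a ≠ b ∧
          (∀ g : PlaneCurve.Poly, PlaneCurve.IsSmoothAt g 0 →
            ((2 * r + 1 : ℕ) : ℕ∞) ≤ PlaneCurve.interMult f g 0 →
            ∃ c : ℕ → ℂ, PlaneCurve.HasLocalEquation g c ∧ (∀ i < r, c i = γ i) ∧
              (c r = a ∨ c r = b)) ∧
          -- both values of the coefficient do occur
          (∀ z : ℂ, z = a ∨ z = b →
            ∃ g : PlaneCurve.Poly, PlaneCurve.IsSmoothAt g 0 ∧
              ((2 * r + 1 : ℕ) : ℕ∞) ≤ PlaneCurve.interMult f g 0 ∧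
              ∃ c : ℕ → ℂ, PlaneCurve.HasLocalEquation g c ∧ c r = z)) := by
  refine ⟨?_, ?_, ?_, ?_, ?_⟩
  · rintro P (h | h) g hg he
    · obtain ⟨γ, hγ, -, hi⟩ := PlaneCurve.exists_parametrization hg
      obtain ⟨-, h₁, h₂, -, -, hh⟩ := h.isOddType hr
      rw [hi] at he ⊢
      exact PlaneCurve.exists_even_of_contactPair (hh γ hγ).1 (hh γ hγ).2 he
    · obtain ⟨γ, hγ, -, hi⟩ := PlaneCurve.exists_parametrization hg
      obtain ⟨h₁, -, hh⟩ := h.isEvenType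
      rw [hi] at he ⊢
      exact PlaneCurve.exists_even_of_min (hh γ hγ) he
  · exact fun P h => PlaneCurve.exists_contact_of_isOddType (h.isOddType hr)
  · exact fun P h => PlaneCurve.exists_contact_of_isEvenType h.isEvenType
  · intro h hv
    have H := h.isEvenType
    rw [PlaneCurve.translate_zero] at H
    exact PlaneCurve.localEquation_of_isEvenType hr h.multO_eq H hv
  · intro h2 h hv
    have H := h.isOddType hr
    rw [PlaneCurve.translate_zero] at H
    -- The condition s ≥ 2 becomes r ≥ 2 and excludes the node with its two tangents.
    exact PlaneCurve.localEquation_of_isOddType (by omega) h.multO_eq H hv
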